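/- For $x\in\mathbb R^2$, an interval $J\subset[0,1]$ and an integrable function $g:[0,1]\to\mathbb C$, let $$(\mathcal E_J g)(x)=\int_J g(\xi)\,e^{2\pi i(\xi x_1+\xi^2x_2)}\,d\xi .$$ For an axis-parallel square $B\subset\mathbb R^2$ with center $c$ and side length $R$, let $w_B(x)=\left(1+\frac{|x-c|}{R}\right)^{-100}$, where $|\cdot|$ is the Euclidean norm, and let $\|f\|_{L^6(w_B)}=\left(\int_{\mathbb R^2}|f(x)|^6w_B(x)\,dx\right)^{1/6}$. Let $\mathbb N^{-1}=\{1/n: n\geq 1 \text{ an integer}\}$. For $\delta\in\mathbb N^{-1}$, let $P_\delta([0,1])$ be the partition of $[0,1]$ into $\delta^{-1}$ intervals of length $\delta$, and let $D(\delta)\in[0,\infty]$ be the best (smallest) constant such that $$\|\mathcal E_{[0,1]}g\|_{L^6(B)}\le D(\delta)\Big(\sum_{J\in P_\delta([0,1])}\|\mathcal E_Jg\|_{L^6(w_B)}^2\Big)^{1/2}$$ for all integrable $g:[0,1]\to\mathbb C$ and all axis-parallel squares $B\subset\mathbb R^2$ of side length $\delta^{-2}$. Then for every $0<\varepsilon<1/100$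 and every $\delta\in\mathbb N^{-1}$, $$D(\delta)\le 2^{200^{1/\varepsilon}}\,\delta^{-\varepsilon}.$$ -/

import Mathlib

open MeasureTheory

noncomputable section

namespace ParabolaDecoupling

/-- The plane `ℝ²` with its Euclidean norm and Lebesgue measure. -/
abbrev Plane : Type := EuclideanSpace ℝ (Fin 2)

/-- The set `ℕ⁻¹ = {1/n : n a positive integer}`. -/
def natInv : Set ℝ := {δ | ∃ n : ℕ, 0 < n ∧ δ = (n : ℝ)⁻¹}

/-- The character `e(a) = exp(2πia)`. -/
def e (a : ℝ) : ℂ := Complex.exp (2 * Real.pi * Complex.I * a)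

/-- The extension operator for the parabola,
`(E_J g)(x) = ∫_J g(ξ) e(ξ x₁ + ξ² x₂) dξ`. -/
def extOp (J : Set ℝ) (g : ℝ → ℂ) (x : Plane) : ℂ :=
  ∫ ξ in J, g ξ * e (ξ * x 0 + ξ ^ 2 * x 1)

/-- The axis-parallel square `B(c, R)` with centre `c` and side length `R`. -/
def square (c : Plane) (R : ℝ) : Set Plane := {x | ∀ i, |x i - c i| ≤ R / 2}

/-- The weight `w_B(x) = (1 + |x - c| / R)^(-100)` adapted to the square `B = B(c, R)`. -/
def weight (c : Plane) (R : ℝ) (x : Plane) : ℝ := ((1 + ‖x - c‖ / R) ^ 100)⁻¹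

/-- `‖f‖_{L⁶(B)}` for the square `B = B(c, R)`. -/
def normL6 (c : Plane) (R : ℝ) (f : Plane → ℂ) : ENNReal :=
  eLpNorm f 6 (volume.restrict (square c R))

/-- `‖f‖_{L⁶(w_B)} = (∫ |f|⁶ w_B)^(1/6)` for the square `B = B(c, R)`. -/
def normL6Weight (c : Plane) (R : ℝ) (f : Plane → ℂ) : ENNReal :=
  eLpNorm f 6 (volume.withDensity fun x => ENNReal.ofReal (weight c R x))

/-- The `j`-th interval `[jδ, (j+1)δ]` (`0 ≤ j < 1/δ`) of the partition `P_δ([0,1])`. -/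
def cap (δ : ℝ) (j : ℕ) : Set ℝ := Set.Icc (j * δ) ((j + 1) * δ)

/-- `(∑_{J ∈ P_δ([0,1])} ‖E_J g‖²_{L⁶(w_B)})^(1/2)` for `δ ∈ ℕ⁻¹` and the square `B = B(c, R)`;
the partition has `1/δ` members (the floor is exact for `δ ∈ ℕ⁻¹`). -/
def squareSum (δ : ℝ) (c : Plane) (R : ℝ) (g : ℝ → ℂ) : ENNReal :=
  (∑ j ∈ Finset.range ⌊δ⁻¹⌋₊, normL6Weight c R (extOp (cap δ j) g) ^ 2) ^ (1 / 2 : ℝ)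

/-- `C` is admissible in the `l²L⁶` decoupling inequality at scale `δ`: for all
integrable `g` on `[0,1]` and all squares `B` of side length `δ⁻²`,
`‖E_{[0,1]} g‖_{L⁶(B)} ≤ C (∑_{J ∈ P_δ([0,1])} ‖E_J g‖²_{L⁶(w_B)})^(1/2)`. -/
def IsDecouplingBound (δ : ℝ) (C : ENNReal) : Prop :=
  ∀ g : ℝ → ℂ, IntegrableOn g (Set.Icc 0 1) → ∀ c : Plane,
    normL6 c (δ ^ (-2 : ℤ)) (extOp (Set.Icc 0 1) g) ≤ C * squareSum δ c (δ ^ (-2 : ℤ)) g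

/-- The decoupling constant `D(δ)`, the best constant in the decoupling inequality. It takes
values in `[0, ∞]`, so that it is `∞` if no finite constant is admissible. -/
def D (δ : ℝ) : ENNReal := sInf {C | IsDecouplingBound δ C}

end ParabolaDecoupling

end

/-!
The proof is the `l²` decoupling version of efficient congruencing. Localisation to squares is
replaced by a finite measure `μ` whose Fourier transform vanishes outside a small neighbourhood of
the origin (`Adapted`), and `E_J g` by finite sums of the characters `e(ξp + ξ²q)` with `ξ ∈ J`
(`trig`). Products of such sums are again trigonometric sums with known frequencies, so all
orthogonality is exact and no weights have to be tracked. The neighbourhood is measured by the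
heights `w₂ - 2t w₁` above all tangents of the parabola, which makes the class of adapted measures
exactly invariant under parabolic rescaling (`Adapted.rescale`). A decoupling inequality for all
coordinates at scale `2^(-(k-s))` therefore applies to each piece over an interval of length
`2^(-s)` (`ParabolicSum.lpNorm_piece_sq_le`).

Let `I`, `I'` be intervals at distance at least `2^(-m)`, with `I'` of length `2^(-r)`. Relative to
the tangent at `I'`, the frequencies of `|f_I'|⁴` have height `O(4^(-r))`, whereas two points of `I`
at distance `d` differ in height by at least `2^(1-m) d`. So in `∫ |f_I|² |f_I'|⁴` the pieces of
`f_I` over intervals of length `4^(-r)` are almost orthogonal, at a cost of `2^(m+3)`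
(`integral_mul_conj_mul_eq_zero`, `integral_sq_sum_le_of_almost_orthogonal`). For each such piece
`f_J`, Cauchy–Schwarz bounds `∫ |f_J|² |f_I'|⁴` by the geometric mean of `∫ |f_I'|² |f_J|⁴`, the same
quantity with the roles exchanged and `r` doubled, and of `∫ |f_I'|⁶`, to which decoupling at the
coarser scale `2^(-(k-r))` applies (`ParabolicSum.bilinearBound_step`). Under the inductive
hypothesis `D(δ)² ≤ Γ δ^(-2ε)` at coarser scales, each of `N` iterations gains the same power
`2^(-3εm)` (`ParabolicSum.bilinearBound_iterate`). Together with the reduction of `‖f‖₆²` to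
separated pairs (`ParabolicSum.lpNorm_sq_le_of_bilinearBound`), the choice `m = N = ⌈2/ε⌉` closes an
induction on the scale with `Γ = 2^(N 2^N)`; the trivial bound covers the scales `k < N 2^N`
(`decouples_of_pos`).

The statement on squares follows by taking for `μ` a density that is a product of dilates of
`sinc(πx)^100`: bounded below on the square, dominated by the weight, and band-limited
(`integral_kern_mul_e`). The functions `E_J g` are bounded pointwise limits of trigonometric sums
(`exists_tendsto_extOp`), and scales `1/n` are compared with dyadic ones by a dilation
(`isDecouplingBound_of_decouples`).
-/

open MeasureTheory

noncomputable section

namespace ParabolaDecoupling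

/-! ### Bounded measurable functions on a finite measure space -/

section Bounded

variable {X : Type*} [MeasurableSpace X]

/-- Bounded measurable functions; on a finite measure space all their moments are finite. -/
structure BddMeas {E : Type*} [NormedAddCommGroup E] [MeasurableSpace E] (f : X → E) : Prop where
  meas : Measurable f
  bdd : ∃ C, ∀ x, ‖f x‖ ≤ C

namespace BddMeas

lemma const {E : Type*} [NormedAddCommGroup E] [MeasurableSpace E] (c : E) :
    BddMeas (fun _ : X => c) := ⟨measurable_const, ‖c‖, fun _ => le_rfl⟩

lemma norm {f : X → ℂ} (hf : BddMeas f) : BddMeas (fun x => ‖f x‖) :=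
  ⟨hf.meas.norm, hf.bdd.imp fun C h x => by simpa using h x⟩

lemma conj {f : X → ℂ} (hf : BddMeas f) : BddMeas (fun x => (starRingEnd ℂ) (f x)) :=
  ⟨Complex.continuous_conj.measurable.comp hf.meas, hf.bdd.imp fun C h x => by simpa using h x⟩

lemma add {f g : X → ℂ} (hf : BddMeas f) (hg : BddMeas g) : BddMeas (fun x => f x + g x) := by
  obtain ⟨C, hC⟩ := hf.bdd
  obtain ⟨D, hD⟩ := hg.bdd
  exact ⟨hf.meas.add hg.meas, C + D, fun x => (norm_add_le _ _).trans (add_le_add (hC x) (hD x))⟩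

lemma mul {E : Type*} [NormedRing E] [MeasurableSpace E] [MeasurableMul₂ E] {f g : X → E}
    (hf : BddMeas f) (hg : BddMeas g) : BddMeas (fun x => f x * g x) := by
  obtain ⟨C, hC⟩ := hf.bdd
  obtain ⟨D, hD⟩ := hg.bdd
  refine ⟨hf.meas.mul hg.meas, C * D, fun x => (norm_mul_le _ _).trans ?_⟩
  exact mul_le_mul (hC x) (hD x) (norm_nonneg _) ((norm_nonneg _).trans (hC x))

lemma pow {f : X → ℝ} (hf : BddMeas f) (n : ℕ) : BddMeas (fun x => f x ^ n) := by
  obtain ⟨C, hC⟩ := hf.bdd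
  refine ⟨hf.meas.pow_const n, C ^ n, fun x => ?_⟩
  rw [norm_pow]
  exact pow_le_pow_left₀ (norm_nonneg _) (hC x) n

lemma sum {ι : Type*} {f : ι → X → ℂ} {s : Finset ι} (hf : ∀ i ∈ s, BddMeas (f i)) :
    BddMeas (fun x => ∑ i ∈ s, f i x) := by
  classical
  induction s using Finset.induction_on with
  | empty => simpa using const (X := X) (0 : ℂ)
  | insert i s hi ih =>
    simp only [Finset.sum_insert hi]
    exact (hf i (by simp)).add (ih fun j hj => hf j (by simp [hj]))

lemma memLp {E : Type*} [NormedAddCommGroup E] [MeasurableSpace E] [BorelSpace E]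
    [SecondCountableTopology E] {f : X → E} (hf : BddMeas f) (r : ENNReal)
    (μ : Measure X) [IsFiniteMeasure μ] : MemLp f r μ := by
  obtain ⟨C, hC⟩ := hf.bdd
  exact MemLp.of_bound hf.meas.aestronglyMeasurable C (Filter.Eventually.of_forall hC)

lemma integrable {E : Type*} [NormedAddCommGroup E] [MeasurableSpace E] [BorelSpace E]
    [SecondCountableTopology E] {f : X → E} (hf : BddMeas f)
    (μ : Measure X) [IsFiniteMeasure μ] : Integrable f μ :=
  memLp_one_iff_integrable.1 (hf.memLp 1 μ)

end BddMeas

variable (μ : Measure X)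

lemma sq_integral_mul_le [IsFiniteMeasure μ] {u v : X → ℝ} (hu : BddMeas u) (hv : BddMeas v)
    (hu0 : ∀ x, 0 ≤ u x) (hv0 : ∀ x, 0 ≤ v x) :
    (∫ x, u x * v x ∂μ) ^ 2 ≤ (∫ x, u x ^ 2 ∂μ) * ∫ x, v x ^ 2 ∂μ := by
  have h := integral_mul_le_Lp_mul_Lq_of_nonneg (μ := μ) (p := 2) (q := 2)
    (Real.HolderConjugate.two_two) (Filter.Eventually.of_forall hu0)
    (Filter.Eventually.of_forall hv0) (hu.memLp _ μ) (hv.memLp _ μ)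
  have h0 : 0 ≤ ∫ x, u x * v x ∂μ := integral_nonneg fun x => mul_nonneg (hu0 x) (hv0 x)
  have h1 : 0 ≤ ∫ x, u x ^ 2 ∂μ := integral_nonneg fun x => sq_nonneg _
  have h2 : 0 ≤ ∫ x, v x ^ 2 ∂μ := integral_nonneg fun x => sq_nonneg _
  simp only [Real.rpow_two, ← Real.sqrt_eq_rpow] at h
  calc _ ≤ _ := pow_le_pow_left₀ h0 h 2
    _ = _ := by rw [mul_pow, Real.sq_sqrt h1, Real.sq_sqrt h2]

lemma lpNorm_pow_eq {f : X → ℂ} (hf : BddMeas f) {n : ℕ} (hn : n ≠ 0) :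
    lpNorm f n μ ^ n = ∫ x, ‖f x‖ ^ n ∂μ := by
  have hi : 0 ≤ ∫ x, ‖f x‖ ^ n ∂μ := integral_nonneg fun x => by positivity
  rw [lpNorm_eq_integral_norm_rpow_toReal (by exact_mod_cast hn) (by simp)
    hf.meas.aestronglyMeasurable]
  simp only [ENNReal.toReal_natCast, Real.rpow_natCast]
  rw [← Real.rpow_natCast, ← Real.rpow_mul hi, inv_mul_cancel₀ (by exact_mod_cast hn),
    Real.rpow_one]

lemma lpNorm_six_pow {f : X → ℂ} (hf : BddMeas f) : lpNorm f 6 μ ^ 6 = ∫ x, ‖f x‖ ^ 6 ∂μ := by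
  exact_mod_cast lpNorm_pow_eq μ hf (n := 6) (by norm_num)

lemma lpNorm_three_pow {f : X → ℂ} (hf : BddMeas f) :
    lpNorm f 3 μ ^ 3 = ∫ x, ‖f x‖ ^ 3 ∂μ := by
  exact_mod_cast lpNorm_pow_eq μ hf (n := 3) (by norm_num)

/-- The asymmetric bilinear quantity `∫ |f|² |g|⁴`. -/
def mixed (f g : X → ℂ) : ℝ := ∫ x, ‖f x‖ ^ 2 * ‖g x‖ ^ 4 ∂μ

lemma mixed_nonneg (f g : X → ℂ) : 0 ≤ mixed μ f g := integral_nonneg fun x => by positivity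

lemma mixed_sq_le [IsFiniteMeasure μ] {f g : X → ℂ} (hf : BddMeas f) (hg : BddMeas g) :
    mixed μ f g ^ 2 ≤ mixed μ g f * lpNorm g 6 μ ^ 6 := by
  have h := sq_integral_mul_le μ (u := fun x => ‖f x‖ ^ 2 * ‖g x‖) (v := fun x => ‖g x‖ ^ 3)
    ((hf.norm.pow 2).mul hg.norm) (hg.norm.pow 3) (fun x => by positivity) (fun x => by positivity)
  rw [lpNorm_six_pow μ hg]
  refine le_trans (le_of_eq ?_) (h.trans (le_of_eq ?_))
  · unfold mixed; congr 2; ext x; ring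
  · unfold mixed; congr 1 <;> (congr 1; ext x; ring)

/-- Hölder's inequality with exponents `3` and `3/2`, obtained by iterating Cauchy–Schwarz. -/
lemma mixed_pow_three_le [IsFiniteMeasure μ] {f g : X → ℂ} (hf : BddMeas f) (hg : BddMeas g) :
    mixed μ f g ^ 3 ≤ lpNorm f 6 μ ^ 6 * (lpNorm g 6 μ ^ 6) ^ 2 := by
  have h1 := mixed_sq_le μ hf hg
  have h2 := mixed_sq_le μ hg hf
  have h0 := mixed_nonneg μ f g
  have h0' := mixed_nonneg μ g f
  set a := mixed μ f g
  set b := mixed μ g f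
  have hF : 0 ≤ lpNorm f 6 μ ^ 6 := by positivity
  have hG : 0 ≤ lpNorm g 6 μ ^ 6 := by positivity
  set F := lpNorm f 6 μ ^ 6
  set G := lpNorm g 6 μ ^ 6
  rcases h0.eq_or_lt with h | h
  · rw [← h, zero_pow three_ne_zero]; positivity
  refine le_of_mul_le_mul_left ?_ h
  calc a * a ^ 3 = (a ^ 2) ^ 2 := by ring
    _ ≤ (b * G) ^ 2 := pow_le_pow_left₀ (sq_nonneg a) h1 2
    _ = b ^ 2 * G ^ 2 := by ring
    _ ≤ (a * F) * G ^ 2 := by gcongr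
    _ = _ := by ring

lemma lpNorm_three_mul_pow_le [IsFiniteMeasure μ] {f g : X → ℂ}
    (hf : BddMeas f) (hg : BddMeas g) :
    (lpNorm (fun x => f x * g x) 3 μ ^ 3) ^ 2 ≤ mixed μ f g * mixed μ g f := by
  have h := sq_integral_mul_le μ (u := fun x => ‖f x‖ * ‖g x‖ ^ 2)
    (v := fun x => ‖g x‖ * ‖f x‖ ^ 2)
    (hf.norm.mul (hg.norm.pow 2)) (hg.norm.mul (hf.norm.pow 2))
    (fun x => by positivity) (fun x => by positivity)
  rw [lpNorm_three_pow μ (hf.mul hg)]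
  refine le_trans (le_of_eq ?_) (h.trans (le_of_eq ?_))
  · congr 2; ext x; rw [norm_mul]; ring
  · unfold mixed; congr 1 <;> (congr 1; ext x; ring)

lemma lpNorm_three_mul_le [IsFiniteMeasure μ] {f g : X → ℂ}
    (hf : BddMeas f) (hg : BddMeas g) :
    lpNorm (fun x => f x * g x) 3 μ ≤ lpNorm f 6 μ * lpNorm g 6 μ := by
  have h := sq_integral_mul_le μ (u := fun x => ‖f x‖ ^ 3) (v := fun x => ‖g x‖ ^ 3)
    (hf.norm.pow 3) (hg.norm.pow 3) (fun x => by positivity) (fun x => by positivity)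
  refine le_of_pow_le_pow_left₀ (n := 6) (by norm_num) (mul_nonneg lpNorm_nonneg lpNorm_nonneg) ?_
  rw [mul_pow, lpNorm_six_pow μ hf, lpNorm_six_pow μ hg]
  calc lpNorm (fun x => f x * g x) 3 μ ^ 6
      = (lpNorm (fun x => f x * g x) 3 μ ^ 3) ^ 2 := by ring
    _ = (∫ x, ‖f x‖ ^ 3 * ‖g x‖ ^ 3 ∂μ) ^ 2 := by
      rw [lpNorm_three_pow μ (hf.mul hg)]
      simp only [norm_mul, mul_pow]
    _ ≤ _ := h
    _ = _ := by simp only [← pow_mul]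

lemma lpNorm_six_sq {f : X → ℂ} (hf : BddMeas f) :
    lpNorm f 6 μ ^ 2 = lpNorm (fun x => f x * f x) 3 μ := by
  refine (pow_left_inj₀ (by positivity) lpNorm_nonneg (n := 3) (by norm_num)).1 ?_
  rw [← pow_mul, lpNorm_six_pow μ hf, lpNorm_three_pow μ (hf.mul hf)]
  congr 1; ext x; rw [norm_mul]; ring

/-- Almost orthogonality: if `∫ gᵤ ḡᵥ w` vanishes for `|u - v| > L`, then
`∫ |∑ gᵤ|² w ≤ (2L + 1) ∑ ∫ |gᵤ|² w`. -/
lemma integral_sq_sum_le_of_almost_orthogonal [IsFiniteMeasure μ] {M L : ℕ} {g : ℕ → X → ℂ} {w : X → ℝ}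
    (hg : ∀ u < M, BddMeas (g u)) (hw : BddMeas w) (hw0 : ∀ x, 0 ≤ w x)
    (horth : ∀ u < M, ∀ v < M, u + L < v →
      ∫ x, g u x * (starRingEnd ℂ) (g v x) * (w x : ℂ) ∂μ = 0) :
    ∫ x, ‖∑ u ∈ Finset.range M, g u x‖ ^ 2 * w x ∂μ ≤
      (2 * L + 1) * ∑ u ∈ Finset.range M, ∫ x, ‖g u x‖ ^ 2 * w x ∂μ := by
  have hwC : BddMeas (fun x => (w x : ℂ)) :=
    ⟨Complex.continuous_ofReal.measurable.comp hw.meas,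
      hw.bdd.imp fun C h x => by simpa using h x⟩
  set q : ℕ → ℝ := fun u => ∫ x, ‖g u x‖ ^ 2 * w x ∂μ with hq
  have hq0 : ∀ u, 0 ≤ q u := fun u => integral_nonneg fun x => mul_nonneg (by positivity) (hw0 x)
  have hint : ∀ u < M, ∀ v < M,
      BddMeas (fun x => g u x * (starRingEnd ℂ) (g v x) * (w x : ℂ)) :=
    fun u hu v hv => ((hg u hu).mul (hg v hv).conj).mul hwC
  have hsq : ∀ u < M, BddMeas (fun x => ‖g u x‖ ^ 2 * w x) :=
    fun u hu => ((hg u hu).norm.pow 2).mul hw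
  set c : ℕ → ℕ → ℂ := fun u v => ∫ x, g u x * (starRingEnd ℂ) (g v x) * (w x : ℂ) ∂μ with hc
  have hsymm : ∀ u v, c v u = (starRingEnd ℂ) (c u v) := by
    intro u v
    simp only [hc]
    rw [← integral_conj]
    congr 1; ext x
    simp only [map_mul, Complex.conj_conj, Complex.conj_ofReal]; ring
  have hcle : ∀ u < M, ∀ v < M, ‖c u v‖ ≤
      if u ≤ v + L ∧ v ≤ u + L then (q u + q v) / 2 else 0 := by
    intro u hu v hv
    split_ifs with h
    · calc ‖c u v‖ ≤ ∫ x, ‖g u x * (starRingEnd ℂ) (g v x) * (w x : ℂ)‖ ∂μ :=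
            norm_integral_le_integral_norm _
        _ ≤ ∫ x, (‖g u x‖ ^ 2 * w x + ‖g v x‖ ^ 2 * w x) / 2 ∂μ := by
          refine integral_mono ((hint u hu v hv).integrable μ).norm ?_ ?_
          · exact (((hsq u hu).integrable μ).add ((hsq v hv).integrable μ)).div_const 2
          · intro x
            simp only [norm_mul, RCLike.norm_conj, Complex.norm_real, Real.norm_eq_abs,
              abs_of_nonneg (hw0 x)]
            nlinarith [mul_nonneg (sq_nonneg (‖g u x‖ - ‖g v x‖)) (hw0 x)]
        _ = _ := by
          rw [integral_div, integral_add ((hsq u hu).integrable μ) ((hsq v hv).integrable μ)]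
    · have : c u v = 0 := by
        rcases not_and_or.1 h with h | h
        · rw [hsymm v u, hc]
          simp only
          rw [horth v hv u hu (by omega), map_zero]
        · exact horth u hu v hv (by omega)
      simp [this]
  have hexp : ((∫ x, ‖∑ u ∈ Finset.range M, g u x‖ ^ 2 * w x ∂μ : ℝ) : ℂ) =
      ∑ u ∈ Finset.range M, ∑ v ∈ Finset.range M, c u v := by
    refine (integral_ofReal (𝕜 := ℂ)).symm.trans ?_
    have : ∀ x, ((‖∑ u ∈ Finset.range M, g u x‖ ^ 2 * w x : ℝ) : ℂ) =
        ∑ u ∈ Finset.range M, ∑ v ∈ Finset.range M,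
          g u x * (starRingEnd ℂ) (g v x) * (w x : ℂ) := by
      intro x
      push_cast
      rw [← Complex.mul_conj', map_sum, Finset.sum_mul_sum, Finset.sum_mul]
      simp only [Finset.sum_mul]
    refine (integral_congr_ae (Filter.Eventually.of_forall this)).trans ?_
    rw [integral_finsetSum]
    · refine Finset.sum_congr rfl fun u hu => ?_
      rw [integral_finsetSum]
      intro v hv
      exact (hint u (Finset.mem_range.1 hu) v (Finset.mem_range.1 hv)).integrable μ
    · intro u hu
      exact integrable_finsetSum _ fun v hv =>
        (hint u (Finset.mem_range.1 hu) v (Finset.mem_range.1 hv)).integrable μ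
  have hcount : ∀ u, ∑ v ∈ Finset.range M, (if u ≤ v + L ∧ v ≤ u + L then (1 : ℝ) else 0) ≤
      2 * L + 1 := by
    intro u
    rw [← Finset.sum_filter, Finset.sum_const, nsmul_eq_mul, mul_one]
    have : ((Finset.range M).filter fun v => u ≤ v + L ∧ v ≤ u + L) ⊆
        Finset.Icc (u - L) (u + L) := by
      intro v hv
      simp only [Finset.mem_filter, Finset.mem_Icc] at hv ⊢
      omega
    have h2 := Finset.card_le_card this
    rw [Nat.card_Icc] at h2
    have h3 : ((Finset.range M).filter fun v => u ≤ v + L ∧ v ≤ u + L).card ≤ 2 * L + 1 := by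
      omega
    exact_mod_cast h3
  have h0 : 0 ≤ ∫ x, ‖∑ u ∈ Finset.range M, g u x‖ ^ 2 * w x ∂μ :=
    integral_nonneg fun x => mul_nonneg (by positivity) (hw0 x)
  calc ∫ x, ‖∑ u ∈ Finset.range M, g u x‖ ^ 2 * w x ∂μ
      = ‖∑ u ∈ Finset.range M, ∑ v ∈ Finset.range M, c u v‖ := by
        rw [← hexp, Complex.norm_real, Real.norm_of_nonneg h0]
    _ ≤ ∑ u ∈ Finset.range M, ∑ v ∈ Finset.range M, ‖c u v‖ :=
        (norm_sum_le _ _).trans (Finset.sum_le_sum fun u _ => norm_sum_le _ _)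
    _ ≤ ∑ u ∈ Finset.range M, ∑ v ∈ Finset.range M,
          ((if u ≤ v + L ∧ v ≤ u + L then (1 : ℝ) else 0) * (q u / 2) +
            (if v ≤ u + L ∧ u ≤ v + L then (1 : ℝ) else 0) * (q v / 2)) := by
        refine Finset.sum_le_sum fun u hu => Finset.sum_le_sum fun v hv => ?_
        refine (hcle u (Finset.mem_range.1 hu) v (Finset.mem_range.1 hv)).trans (le_of_eq ?_)
        simp only [and_comm (a := v ≤ u + L)]
        split_ifs <;> ring
    _ = 2 * ∑ u ∈ Finset.range M, (∑ v ∈ Finset.range M,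
          (if u ≤ v + L ∧ v ≤ u + L then (1 : ℝ) else 0)) * (q u / 2) := by
        simp only [Finset.sum_add_distrib]
        rw [Finset.sum_comm (f := fun u v =>
          (if v ≤ u + L ∧ u ≤ v + L then (1 : ℝ) else 0) * (q v / 2))]
        simp only [Finset.sum_mul]
        ring
    _ ≤ 2 * ∑ u ∈ Finset.range M, (2 * L + 1) * (q u / 2) := by
        gcongr with u hu
        · have := hq0 u; positivity
        · exact hcount u
    _ = _ := by rw [Finset.mul_sum, Finset.mul_sum]; exact Finset.sum_congr rfl fun u _ => by ring

end Bounded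

/-! ### Trigonometric sums with prescribed frequencies -/

lemma e_add (a b : ℝ) : e (a + b) = e a * e b := by
  simp only [e, ← Complex.exp_add]; congr 1; push_cast; ring

lemma norm_e (a : ℝ) : ‖e a‖ = 1 := by
  rw [e, show (2 * Real.pi * Complex.I * a : ℂ) = ((2 * Real.pi * a : ℝ) : ℂ) * Complex.I by
    push_cast; ring]
  exact Complex.norm_exp_ofReal_mul_I _

lemma conj_e (a : ℝ) : (starRingEnd ℂ) (e a) = e (-a) := by
  rw [e, e, ← Complex.exp_conj]; congr 1
  simp [map_ofNat]

lemma e_zero : e 0 = 1 := by simp [e]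

lemma continuous_e : Continuous e := by unfold e; fun_prop

section Trig

open scoped Pointwise

variable {X : Type*}

/-- The character `x ↦ e(w₁ p(x) + w₂ q(x))` in the coordinate functions `p, q` of `X`. -/
def char (p q : X → ℝ) (w : ℝ × ℝ) (x : X) : ℂ := e (w.1 * p x + w.2 * q x)

/-- Finite trigonometric sums with frequencies in `Ω`. -/
def trig (p q : X → ℝ) (Ω : Set (ℝ × ℝ)) : Submodule ℂ (X → ℂ) :=
  Submodule.span ℂ (char p q '' Ω)

variable {p q : X → ℝ} {Ω Ω' : Set (ℝ × ℝ)} {f g : X → ℂ}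

lemma char_mem_trig {w : ℝ × ℝ} (hw : w ∈ Ω) : char p q w ∈ trig p q Ω :=
  Submodule.subset_span ⟨w, hw, rfl⟩

lemma trig_mono (h : Ω ⊆ Ω') : trig p q Ω ≤ trig p q Ω' :=
  Submodule.span_mono (Set.image_mono h)

lemma char_mul (w w' : ℝ × ℝ) : char p q w * char p q w' = char p q (w + w') := by
  ext x
  simp only [char, Pi.mul_apply, ← e_add, Prod.fst_add, Prod.snd_add]
  congr 1; ring

lemma mul_mem_trig (hf : f ∈ trig p q Ω) (hg : g ∈ trig p q Ω') :
    f * g ∈ trig p q (Ω + Ω') := by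
  have h := Submodule.mul_mem_mul hf hg
  rw [trig, trig, Submodule.span_mul_span] at h
  refine Submodule.span_mono ?_ h
  rintro _ ⟨_, ⟨w, hw, rfl⟩, _, ⟨w', hw', rfl⟩, rfl⟩
  exact ⟨w + w', Set.add_mem_add hw hw', (char_mul w w').symm⟩

lemma conj_mem_trig (hf : f ∈ trig p q Ω) :
    (fun x => (starRingEnd ℂ) (f x)) ∈ trig p q (-Ω) := by
  induction hf using Submodule.span_induction with
  | mem f hf =>
    obtain ⟨w, hw, rfl⟩ := hf
    refine Submodule.subset_span ⟨-w, by simpa using hw, ?_⟩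
    ext x
    simp only [char, conj_e, Prod.fst_neg, Prod.snd_neg]
    congr 1; ring
  | zero =>
    convert (trig p q (-Ω)).zero_mem using 1
    ext x; simp
  | add f g _ _ hf hg =>
    convert (trig p q (-Ω)).add_mem hf hg using 1
    ext x; simp
  | smul c f _ hf =>
    convert (trig p q (-Ω)).smul_mem ((starRingEnd ℂ) c) hf using 1
    ext x; simp

/-- The arc of the parabola above `[a, b]`. -/
def arc (a b : ℝ) : Set (ℝ × ℝ) := (fun ξ => (ξ, ξ ^ 2)) '' Set.Icc a b

lemma arc_mono {a b a' b' : ℝ} (h : a' ≤ a) (h' : b ≤ b') : arc a b ⊆ arc a' b' :=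
  Set.image_mono (Set.Icc_subset_Icc h h')

lemma rescale_mem_trig {α σ a b : ℝ} (hσ : 0 < σ)
    (hf : f ∈ trig p q (arc (α + σ * a) (α + σ * b))) :
    (fun x => char p q (-α, -α ^ 2) x * f x) ∈
      trig (fun x => σ * (p x + 2 * α * q x)) (fun x => σ ^ 2 * q x) (arc a b) := by
  set p' := fun x => σ * (p x + 2 * α * q x)
  set q' := fun x => σ ^ 2 * q x
  induction hf using Submodule.span_induction with
  | mem f hf =>
    obtain ⟨_, ⟨ξ, hξ, rfl⟩, rfl⟩ := hf
    refine Submodule.subset_span ⟨_, ⟨(ξ - α) / σ, ⟨?_, ?_⟩, rfl⟩, ?_⟩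
    · rw [le_div_iff₀ hσ]; linarith [hξ.1]
    · rw [div_le_iff₀ hσ]; linarith [hξ.2]
    · ext x
      simp only [char, ← e_add, p', q']
      congr 1
      field_simp
      ring
  | zero =>
    convert (trig p' q' (arc a b)).zero_mem using 1
    ext x; simp
  | add f g _ _ hf hg =>
    convert (trig p' q' (arc a b)).add_mem hf hg using 1
    ext x; simp [mul_add]
  | smul c f _ hf =>
    convert (trig p' q' (arc a b)).smul_mem c hf using 1
    ext x; simp only [Pi.smul_apply, smul_eq_mul]; ring

variable [MeasurableSpace X]

lemma bddMeas_char (hp : Measurable p) (hq : Measurable q) (w : ℝ × ℝ) :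
    BddMeas (char p q w) := by
  refine ⟨continuous_e.measurable.comp (by fun_prop), 1, fun x => ?_⟩
  simp [char, norm_e]

lemma bddMeas_of_mem_trig (hp : Measurable p) (hq : Measurable q) (hf : f ∈ trig p q Ω) :
    BddMeas f := by
  induction hf using Submodule.span_induction with
  | mem f hf =>
    obtain ⟨w, hw, rfl⟩ := hf
    exact bddMeas_char hp hq w
  | zero => exact BddMeas.const 0
  | add f g _ _ hf hg => exact hf.add hg
  | smul c f _ hf => exact (BddMeas.const c).mul hf

lemma integral_eq_zero_of_mem_trig {μ : Measure X} [IsFiniteMeasure μ]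
    (hp : Measurable p) (hq : Measurable q) (hΩ : ∀ w ∈ Ω, ∫ x, char p q w x ∂μ = 0)
    (hf : f ∈ trig p q Ω) : ∫ x, f x ∂μ = 0 := by
  have : Integrable f μ ∧ ∫ x, f x ∂μ = 0 := by
    induction hf using Submodule.span_induction with
    | mem f hf =>
      obtain ⟨w, hw, rfl⟩ := hf
      exact ⟨(bddMeas_char hp hq w).integrable μ, hΩ w hw⟩
    | zero => exact ⟨integrable_zero _ _ _, by simp⟩
    | add f g _ _ hf hg =>
      refine ⟨hf.1.add hg.1, ?_⟩
      simp only [Pi.add_apply]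
      rw [integral_add hf.1 hg.1, hf.2, hg.2, add_zero]
    | smul c f _ hf =>
      refine ⟨hf.1.smul c, ?_⟩
      simp only [Pi.smul_apply]
      rw [integral_smul, hf.2, smul_zero]
  exact this.2

/-- Uncertainty principle for `(μ, p, q)` at scale `δ`: the Fourier transform of `μ` in the
coordinates `(p, q)` lives on the set of frequencies `w` that all slopes `2t`, `t ∈ [0,1]`, of the
parabola place within height `δ²`. Testing against all these slopes, instead of a ball of radius
`δ²`, makes the class exactly invariant under parabolic rescaling. -/
def Adapted (μ : Measure X) (p q : X → ℝ) (δ : ℝ) : Prop :=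
  ∀ w : ℝ × ℝ, ∀ t ∈ Set.Icc (0 : ℝ) 1, δ ^ 2 < |w.2 - 2 * t * w.1| →
    ∫ x, char p q w x ∂μ = 0

/-- Parabolic rescaling of the interval `[α, α + σ]` to `[0, 1]`. -/
lemma Adapted.rescale {μ : Measure X} {δ α σ : ℝ} (h : Adapted μ p q (σ * δ)) (hσ : 0 < σ)
    (hα : 0 ≤ α) (hασ : α + σ ≤ 1) :
    Adapted μ (fun x => σ * (p x + 2 * α * q x)) (fun x => σ ^ 2 * q x) δ := by
  intro w t ht hw
  have h1 := h (σ * w.1, 2 * α * σ * w.1 + σ ^ 2 * w.2) (α + σ * t)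
    ⟨by nlinarith [ht.1], by nlinarith [ht.2]⟩ ?_
  · rw [← h1]
    congr 1; ext x
    simp only [char]
    congr 1; ring
  · simp only
    rw [show 2 * α * σ * w.1 + σ ^ 2 * w.2 - 2 * (α + σ * t) * (σ * w.1) =
      σ ^ 2 * (w.2 - 2 * t * w.1) by ring, abs_mul, abs_of_pos (by positivity : 0 < σ ^ 2), mul_pow]
    exact mul_lt_mul_of_pos_left hw (by positivity)

/-- Transversal orthogonality: let `H` have frequencies over `[t, t + ρ]`. Two pieces `g₁, g₂`
whose frequencies lie `κ`-separated from `t` (on one side) are orthogonal with weight `|H|⁴`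
once they are at distance more than `d` from each other, `2 κ d ≥ 2 ρ² + δ²`. Subtracting the
tangent at `t`, the frequencies of `|H|⁴` have height at most `2ρ²`, while those of `g₁ ḡ₂` have
height at least `2κd`. -/
lemma integral_mul_conj_mul_eq_zero {μ : Measure X} [IsFiniteMeasure μ] {δ t ρ κ d : ℝ}
    (hp : Measurable p) (hq : Measurable q) (hμ : Adapted μ p q δ) (ht : t ∈ Set.Icc (0 : ℝ) 1)
    {g₁ g₂ H : X → ℂ} {a₁ b₁ a₂ b₂ : ℝ}
    (h₁ : g₁ ∈ trig p q (arc a₁ b₁)) (h₂ : g₂ ∈ trig p q (arc a₂ b₂))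
    (hH : H ∈ trig p q (arc t (t + ρ))) (hd0 : 0 < d)
    (hd : b₁ + d < a₂) (hκ0 : 0 < κ)
    (hκ : t + κ ≤ a₁ ∨ b₂ + κ ≤ t) (hδ : 2 * ρ ^ 2 + δ ^ 2 ≤ 2 * κ * d) :
    ∫ x, g₁ x * (starRingEnd ℂ) (g₂ x) * ((‖H x‖ ^ 4 : ℝ) : ℂ) ∂μ = 0 := by
  have hmem := mul_mem_trig (mul_mem_trig h₁ (conj_mem_trig h₂))
    (mul_mem_trig (mul_mem_trig hH hH) (mul_mem_trig (conj_mem_trig hH) (conj_mem_trig hH)))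
  have hfun : (fun x => g₁ x * (starRingEnd ℂ) (g₂ x) * ((‖H x‖ ^ 4 : ℝ) : ℂ)) =
      (g₁ * fun x => (starRingEnd ℂ) (g₂ x)) * (H * H *
        ((fun x => (starRingEnd ℂ) (H x)) * fun x => (starRingEnd ℂ) (H x))) := by
    ext x
    simp only [Pi.mul_apply]
    have : ((‖H x‖ ^ 4 : ℝ) : ℂ) = (H x * (starRingEnd ℂ) (H x)) ^ 2 := by
      rw [Complex.mul_conj']; push_cast; ring
    rw [this]; ring
  rw [← hfun] at hmem
  refine integral_eq_zero_of_mem_trig hp hq ?_ hmem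
  intro w hw
  obtain ⟨_, ⟨_, ⟨ξ₁, hξ₁, rfl⟩, w₂, hw₂, rfl⟩, _, ⟨_, ⟨_, ⟨η₁, hη₁, rfl⟩, _, ⟨η₂, hη₂, rfl⟩, rfl⟩,
    _, ⟨w₃, hw₃, w₄, hw₄, rfl⟩, rfl⟩, rfl⟩ := hw
  obtain ⟨ξ₂, hξ₂, hw₂⟩ := hw₂
  obtain ⟨η₃, hη₃, hw₃⟩ := hw₃
  obtain ⟨η₄, hη₄, hw₄⟩ := hw₄
  obtain rfl : w₂ = -(ξ₂, ξ₂ ^ 2) := by rw [← neg_neg w₂, ← hw₂]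
  obtain rfl : w₃ = -(η₃, η₃ ^ 2) := by rw [← neg_neg w₃, ← hw₃]
  obtain rfl : w₄ = -(η₄, η₄ ^ 2) := by rw [← neg_neg w₄, ← hw₄]
  refine hμ _ t ht ?_
  have hsq : ∀ η ∈ Set.Icc t (t + ρ), 0 ≤ (η - t) ^ 2 ∧ (η - t) ^ 2 ≤ ρ ^ 2 := fun η hη =>
    ⟨sq_nonneg _, pow_le_pow_left₀ (by linarith [hη.1]) (by linarith [hη.2]) 2⟩
  have e1 := hsq _ hη₁
  have e2 := hsq _ hη₂
  have e3 := hsq _ hη₃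
  have e4 := hsq _ hη₄
  obtain ⟨hξ₁a, hξ₁b⟩ := hξ₁
  obtain ⟨hξ₂a, hξ₂b⟩ := hξ₂
  simp only [Prod.fst_add, Prod.snd_add, Prod.fst_neg, Prod.snd_neg]
  have hgap : d < ξ₂ - ξ₁ := by linarith
  rcases hκ with hκ | hκ
  · have : 2 * κ * d < (ξ₂ - ξ₁) * ((ξ₁ - t) + (ξ₂ - t)) := by
      have : 2 * κ ≤ (ξ₁ - t) + (ξ₂ - t) := by linarith
      nlinarith
    rw [lt_abs]; right
    nlinarith
  · have : 2 * κ * d < (ξ₂ - ξ₁) * ((t - ξ₁) + (t - ξ₂)) := by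
      have : 2 * κ ≤ (t - ξ₁) + (t - ξ₂) := by linarith
      nlinarith
    rw [lt_abs]; left
    nlinarith

end Trig

/-! ### Dyadic pieces -/

section Blocks

/-- The sum of `F` over the `i`-th block of length `L`. -/
def block {A : Type*} [AddCommMonoid A] (L : ℕ) (F : ℕ → A) (i : ℕ) : A :=
  ∑ l ∈ Finset.range L, F (i * L + l)

variable {A : Type*} [AddCommMonoid A]

lemma sum_range_sum_range (F : ℕ → A) (c M L : ℕ) :
    ∑ u ∈ Finset.range M, ∑ l ∈ Finset.range L, F (c + u * L + l) =
      ∑ l ∈ Finset.range (M * L), F (c + l) := by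
  induction M with
  | zero => simp
  | succ M ih =>
    rw [Finset.sum_range_succ, ih, Nat.succ_mul, Finset.sum_range_add]
    simp only [add_assoc]

lemma sum_block (F : ℕ → A) (i M L : ℕ) :
    ∑ u ∈ Finset.range M, block L F (i * M + u) = block (M * L) F i := by
  rw [block, ← sum_range_sum_range]
  refine Finset.sum_congr rfl fun u _ => ?_
  simp only [block]
  refine Finset.sum_congr rfl fun l _ => ?_
  congr 1; ring

lemma sum_block_pow (F : ℕ → A) {k s s' : ℕ} (h : s ≤ s') (h' : s' ≤ k) (i : ℕ) :
    block (2 ^ (k - s)) F i =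
      ∑ u ∈ Finset.range (2 ^ (s' - s)), block (2 ^ (k - s')) F (i * 2 ^ (s' - s) + u) := by
  rw [sum_block, ← pow_add]
  congr 2; omega

lemma block_zero (F : ℕ → A) (L : ℕ) : block L F 0 = ∑ l ∈ Finset.range L, F l := by
  simp [block]

end Blocks

section Pieces

variable {X : Type*} [MeasurableSpace X] {μ : Measure X}

/-- A sequence of trigonometric sums over the `2^k` dyadic arcs of length `2^(-k)` of the
parabola, in coordinates `p, q` with respect to which `μ` is adapted to the scale `2^(-k)`. -/
structure ParabolicSum (μ : Measure X) (p q : X → ℝ) (k : ℕ) (F : ℕ → X → ℂ) : Prop where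
  meas_p : Measurable p
  meas_q : Measurable q
  adapted : Adapted μ p q (2 ^ k)⁻¹
  mem : ∀ l : ℕ, l < 2 ^ k → F l ∈ trig p q (arc (l / 2 ^ k) ((l + 1) / 2 ^ k))

/-- `K` is admissible in the square of the `l²L⁶(μ)` decoupling inequality at scale `2^(-k)`. -/
def Decouples (μ : Measure X) (k : ℕ) (K : ℝ) : Prop :=
  ∀ (p q : X → ℝ) (F : ℕ → X → ℂ), ParabolicSum μ p q k F →
    lpNorm (∑ l ∈ Finset.range (2 ^ k), F l) 6 μ ^ 2 ≤
      K * ∑ l ∈ Finset.range (2 ^ k), lpNorm (F l) 6 μ ^ 2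

/-- The part of `∑ F l` over the `i`-th dyadic interval of length `2^(-s)`. -/
def piece (k : ℕ) (F : ℕ → X → ℂ) (s i : ℕ) : X → ℂ := block (2 ^ (k - s)) F i

/-- The part of `∑ ‖F l‖₆²` over the `i`-th dyadic interval of length `2^(-s)`. -/
def energy (μ : Measure X) (k : ℕ) (F : ℕ → X → ℂ) (s i : ℕ) : ℝ :=
  block (2 ^ (k - s)) (fun l => lpNorm (F l) 6 μ ^ 2) i

lemma energy_nonneg (k : ℕ) (F : ℕ → X → ℂ) (s i : ℕ) : 0 ≤ energy μ k F s i := by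
  rw [energy, block]
  exact Finset.sum_nonneg fun _ _ => sq_nonneg _

variable {p q : X → ℝ} {k : ℕ} {F : ℕ → X → ℂ}

lemma index_lt {k s i l : ℕ} (hs : s ≤ k) (hi : i < 2 ^ s) (hl : l < 2 ^ (k - s)) :
    i * 2 ^ (k - s) + l < 2 ^ k := by
  have h : 2 ^ k = 2 ^ s * 2 ^ (k - s) := by rw [← pow_add]; congr 1; omega
  calc i * 2 ^ (k - s) + l < i * 2 ^ (k - s) + 2 ^ (k - s) := by omega
    _ = (i + 1) * 2 ^ (k - s) := by ring
    _ ≤ 2 ^ s * 2 ^ (k - s) := Nat.mul_le_mul_right _ hi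
    _ = 2 ^ k := h.symm

lemma index_div {k s i : ℕ} (hs : s ≤ k) (y : ℝ) :
    ((i : ℝ) * 2 ^ (k - s) + y) / 2 ^ k = i / 2 ^ s + 1 / 2 ^ s * (y / 2 ^ (k - s)) := by
  have h : (2 : ℝ) ^ k = 2 ^ s * 2 ^ (k - s) := by rw [← pow_add]; congr 1; omega
  rw [h]; field_simp

lemma child_left {s s' : ℕ} (h : s ≤ s') (i u : ℕ) :
    (i : ℝ) / 2 ^ s ≤ ((i * 2 ^ (s' - s) + u : ℕ) : ℝ) / 2 ^ s' := by
  push_cast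
  rw [index_div h]
  have : (0 : ℝ) ≤ 1 / 2 ^ s * (u / 2 ^ (s' - s)) := by positivity
  linarith

lemma child_right {s s' : ℕ} (h : s ≤ s') (i : ℕ) {u : ℕ}
    (hu : u < 2 ^ (s' - s)) :
    (((i * 2 ^ (s' - s) + u : ℕ) : ℝ) + 1) / 2 ^ s' ≤ ((i : ℝ) + 1) / 2 ^ s := by
  push_cast
  rw [add_assoc, index_div h, add_div (i : ℝ) 1]
  have : ((u : ℝ) + 1) / 2 ^ (s' - s) ≤ 1 := by
    rw [div_le_one (by positivity)]; exact_mod_cast hu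
  have : (1 : ℝ) / 2 ^ s * ((u + 1) / 2 ^ (s' - s)) ≤ 1 / 2 ^ s * 1 := by gcongr
  linarith

namespace ParabolicSum

lemma piece_mem (h : ParabolicSum μ p q k F) {s i : ℕ} (hs : s ≤ k) (hi : i < 2 ^ s) :
    piece k F s i ∈ trig p q (arc (i / 2 ^ s) ((i + 1) / 2 ^ s)) := by
  rw [piece, block]
  refine Submodule.sum_mem _ fun l hl => ?_
  have hl := Finset.mem_range.1 hl
  refine trig_mono (arc_mono ?_ ?_) (h.mem _ (index_lt hs hi hl))
  · push_cast
    rw [index_div hs]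
    have : (0 : ℝ) ≤ 1 / 2 ^ s * (l / 2 ^ (k - s)) := by positivity
    linarith
  · push_cast
    rw [add_assoc, index_div hs, add_div (i : ℝ) 1]
    have : ((l : ℝ) + 1) / 2 ^ (k - s) ≤ 1 := by
      rw [div_le_one (by positivity)]; exact_mod_cast hl
    have : (1 : ℝ) / 2 ^ s * ((l + 1) / 2 ^ (k - s)) ≤ 1 / 2 ^ s * 1 := by gcongr
    linarith

lemma bddMeas_piece (h : ParabolicSum μ p q k F) {s i : ℕ} (hs : s ≤ k) (hi : i < 2 ^ s) :
    BddMeas (piece k F s i) :=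
  bddMeas_of_mem_trig h.meas_p h.meas_q (h.piece_mem hs hi)

/-- Parabolic rescaling: a decoupling inequality at scale `2^(-(k-s))` applies to the pieces over
intervals of length `2^(-s)`. -/
lemma lpNorm_piece_sq_le (h : ParabolicSum μ p q k F) {K : ℝ} {s i : ℕ} (hs : s ≤ k) (hi : i < 2 ^ s)
    (hK : Decouples μ (k - s) K) :
    lpNorm (piece k F s i) 6 μ ^ 2 ≤ K * energy μ k F s i := by
  have hunit : ∀ f : X → ℂ, BddMeas f →
      lpNorm (fun x => char p q (-(i / 2 ^ s : ℝ), -(i / 2 ^ s : ℝ) ^ 2) x * f x) 6 μ =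
        lpNorm f 6 μ := by
    intro f hf
    refine (pow_left_inj₀ lpNorm_nonneg lpNorm_nonneg (n := 6) (by norm_num)).1 ?_
    rw [lpNorm_six_pow μ hf, lpNorm_six_pow μ ((bddMeas_char h.meas_p h.meas_q _).mul hf)]
    congr 1; ext x
    rw [norm_mul, char, norm_e, one_mul]
  have hs0 : (0 : ℝ) < 1 / 2 ^ s := by positivity
  have key := hK (fun x => 1 / 2 ^ s * (p x + 2 * (i / 2 ^ s) * q x))
    (fun x => (1 / 2 ^ s) ^ 2 * q x)
    (fun l x => char p q (-(i / 2 ^ s : ℝ), -(i / 2 ^ s : ℝ) ^ 2) x * F (i * 2 ^ (k - s) + l) x)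
    ⟨by have := h.meas_p; have := h.meas_q; fun_prop, by have := h.meas_q; fun_prop, ?_, ?_⟩
  · have e1 : (∑ l ∈ Finset.range (2 ^ (k - s)), fun x =>
        char p q (-(i / 2 ^ s : ℝ), -(i / 2 ^ s : ℝ) ^ 2) x * F (i * 2 ^ (k - s) + l) x) =
        fun x => char p q (-(i / 2 ^ s : ℝ), -(i / 2 ^ s : ℝ) ^ 2) x * piece k F s i x := by
      ext x
      simp only [piece, block, Finset.sum_apply, Finset.mul_sum]
    rw [e1, hunit _ (h.bddMeas_piece hs hi)] at key
    refine key.trans (le_of_eq ?_)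
    rw [energy, block]
    congr 1
    refine Finset.sum_congr rfl fun l hl => ?_
    rw [hunit _ (bddMeas_of_mem_trig h.meas_p h.meas_q
      (h.mem _ (index_lt hs hi (Finset.mem_range.1 hl))))]
  · refine Adapted.rescale ?_ hs0 (by positivity) ?_
    · convert h.adapted using 1
      rw [one_div, ← mul_inv, ← pow_add]
      congr 2; omega
    · rw [← add_div, div_le_one (by positivity)]
      exact_mod_cast hi
  · intro l hl
    refine rescale_mem_trig hs0 ?_
    convert h.mem _ (index_lt hs hi hl) using 3
    · push_cast; rw [index_div hs]
    · push_cast; rw [add_assoc, index_div hs]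

end ParabolicSum

end Pieces

/-! ### The bilinear constants and their iteration -/

section Bilinear

variable {X : Type*} [MeasurableSpace X] {μ : Measure X}

lemma Decouples.mono {k : ℕ} {K K' : ℝ} (h : Decouples μ k K) (hK : K ≤ K') :
    Decouples μ k K' := fun p q F hF =>
  (h p q F hF).trans
    (mul_le_mul_of_nonneg_right hK (Finset.sum_nonneg fun _ _ => sq_nonneg _))

lemma decouples_trivial [IsFiniteMeasure μ] (k : ℕ) : Decouples μ k (2 ^ k) := by
  intro p q F hF
  have h1 : lpNorm (∑ l ∈ Finset.range (2 ^ k), F l) 6 μ ≤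
      ∑ l ∈ Finset.range (2 ^ k), lpNorm (F l) 6 μ :=
    lpNorm_sum_le (fun l hl => (bddMeas_of_mem_trig hF.meas_p hF.meas_q
      (hF.mem l (Finset.mem_range.1 hl))).memLp 6 μ) (by norm_num)
  refine (pow_le_pow_left₀ lpNorm_nonneg h1 2).trans (sq_sum_le_card_mul_sum_sq.trans ?_)
  simp

/-- The dyadic intervals with indices `(s, i)` and `(r, i')` are at distance at least `2^(-m)`. -/
def Separated (m s i r i' : ℕ) : Prop :=
  ((i : ℝ) + 1) / 2 ^ s + 1 / 2 ^ m ≤ i' / 2 ^ r ∨ ((i' : ℝ) + 1) / 2 ^ r + 1 / 2 ^ m ≤ i / 2 ^ s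

/-- `K` is admissible in the bilinear inequality `∫ |f_I|² |f_I'|⁴ ≤ K E_I E_I'²`, where `E_I` is
the energy of `I`, for all `2^(-m)`-separated dyadic intervals `I`, `I'` of lengths `2^(-s)` and
`2^(-r)`. -/
def BilinearBound (μ : Measure X) (k m : ℕ) (F : ℕ → X → ℂ) (s r : ℕ) (K : ℝ) : Prop :=
  ∀ i < 2 ^ s, ∀ i' < 2 ^ r, Separated m s i r i' →
    mixed μ (piece k F s i) (piece k F r i') ≤ K * (energy μ k F s i * energy μ k F r i' ^ 2)

variable {k m : ℕ} {F : ℕ → X → ℂ}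

lemma BilinearBound.mono {s r : ℕ} {K K' : ℝ} (h : BilinearBound μ k m F s r K) (hK : K ≤ K') :
    BilinearBound μ k m F s r K' := fun i hi i' hi' hs =>
  (h i hi i' hi' hs).trans (mul_le_mul_of_nonneg_right hK
    (mul_nonneg (energy_nonneg _ _ _ _) (sq_nonneg _)))

variable {p q : X → ℝ}

namespace ParabolicSum

variable [IsFiniteMeasure μ]

lemma bilinearBound_of_decouples (h : ParabolicSum μ p q k F) {s r : ℕ} (hs : s ≤ k) (hr : r ≤ k)
    {A B : ℝ} (hA0 : 0 ≤ A) (hA : Decouples μ (k - s) A)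
    (hB : Decouples μ (k - r) B) : BilinearBound μ k m F s r (A * B ^ 2) := by
  intro i hi i' hi' _
  have h1 := h.lpNorm_piece_sq_le hs hi hA
  have h2 := h.lpNorm_piece_sq_le hr hi' hB
  have e1 := energy_nonneg (μ := μ) k F s i
  have e2 := energy_nonneg (μ := μ) k F r i'
  have h3 := mixed_pow_three_le μ (h.bddMeas_piece hs hi) (h.bddMeas_piece hr hi')
  refine le_of_pow_le_pow_left₀ (n := 3) (by norm_num) (by positivity) (h3.trans ?_)
  calc lpNorm (piece k F s i) 6 μ ^ 6 * (lpNorm (piece k F r i') 6 μ ^ 6) ^ 2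
      = (lpNorm (piece k F s i) 6 μ ^ 2) ^ 3 * ((lpNorm (piece k F r i') 6 μ ^ 2) ^ 3) ^ 2 := by
        ring
    _ ≤ (A * energy μ k F s i) ^ 3 * ((B * energy μ k F r i') ^ 3) ^ 2 := by gcongr
    _ = _ := by ring

/-- The congruencing step. Transversal orthogonality splits `I` into intervals `J` of length
`|I'|²` at the cost of a factor `2^(m+3)`; Cauchy–Schwarz then exchanges the roles of `J`
and `I'`. -/
lemma bilinearBound_step (h : ParabolicSum μ p q k F) {s r : ℕ} (hsr : s ≤ 2 * r)
    (hrk : 2 * r ≤ k) {K B : ℝ} (hK0 : 0 ≤ K) (hB0 : 0 ≤ B)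
    (hK : BilinearBound μ k m F r (2 * r) K) (hB : Decouples μ (k - r) B) :
    BilinearBound μ k m F s r (2 ^ (m + 3) * Real.sqrt (K * B ^ 3)) := by
  intro i hi i' hi' hsep
  have hs : s ≤ k := hsr.trans hrk
  have hr : r ≤ k := by omega
  have hH := h.bddMeas_piece hr hi'
  set H := piece k F r i'
  set d := 2 * r - s with hd
  have hidx : ∀ u < 2 ^ d, i * 2 ^ d + u < 2 ^ (2 * r) := fun u hu => index_lt hsr hi hu
  have hg : ∀ u < 2 ^ d, BddMeas (piece k F (2 * r) (i * 2 ^ d + u)) := fun u hu =>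
    h.bddMeas_piece hrk (hidx u hu)
  have hsplit : piece k F s i =
      ∑ u ∈ Finset.range (2 ^ d), piece k F (2 * r) (i * 2 ^ d + u) :=
    sum_block_pow F hsr hrk i
  have hESplit : energy μ k F s i =
      ∑ u ∈ Finset.range (2 ^ d), energy μ k F (2 * r) (i * 2 ^ d + u) :=
    sum_block_pow _ hsr hrk i
  have hl := child_left (s := s) (s' := 2 * r) hsr i
  have hrt := fun u hu => child_right (s := s) (s' := 2 * r) hsr i (u := u) hu
  rw [← hd] at hl hrt
  -- each short piece, with the roles exchanged
  have hterm : ∀ u ∈ Finset.range (2 ^ d), mixed μ (piece k F (2 * r) (i * 2 ^ d + u)) H ≤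
      Real.sqrt (K * B ^ 3) *
        (energy μ k F (2 * r) (i * 2 ^ d + u) * energy μ k F r i' ^ 2) := by
    intro u hu
    have hu := Finset.mem_range.1 hu
    have hswap : Separated m r i' (2 * r) (i * 2 ^ d + u) := by
      rcases hsep with h' | h'
      · right; linarith [hrt u hu]
      · left; linarith [hl u]
    have h1 := hK i' hi' _ (hidx u hu) hswap
    have h2 := h.lpNorm_piece_sq_le hr hi' hB
    have h3 := mixed_sq_le μ (hg u hu) hH
    have e1 := energy_nonneg (μ := μ) k F (2 * r) (i * 2 ^ d + u)
    have e2 := energy_nonneg (μ := μ) k F r i'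
    refine le_of_pow_le_pow_left₀ (n := 2) (by norm_num) (by positivity) (h3.trans ?_)
    calc _ = mixed μ H (piece k F (2 * r) (i * 2 ^ d + u)) * (lpNorm H 6 μ ^ 2) ^ 3 := by ring
      _ ≤ (K * (energy μ k F r i' * energy μ k F (2 * r) (i * 2 ^ d + u) ^ 2)) *
          (B * energy μ k F r i') ^ 3 := by gcongr
      _ = Real.sqrt (K * B ^ 3) ^ 2 *
          (energy μ k F (2 * r) (i * 2 ^ d + u) * energy μ k F r i' ^ 2) ^ 2 := by
        rw [Real.sq_sqrt (by positivity)]; ring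
      _ = _ := by ring
  -- transversal orthogonality between distant short pieces
  have horth := integral_sq_sum_le_of_almost_orthogonal μ (M := 2 ^ d) (L := 2 ^ (m + 1))
    (g := fun u => piece k F (2 * r) (i * 2 ^ d + u)) (w := fun x => ‖H x‖ ^ 4)
    hg (hH.norm.pow 4) (fun x => by positivity) (by
      intro u hu v hv huv
      have hHm := h.piece_mem hr hi'
      rw [add_div] at hHm
      have hrr : (2 : ℝ) ^ (2 * r) = (2 ^ r) ^ 2 := by rw [← pow_mul]; congr 1; ring
      refine integral_mul_conj_mul_eq_zero (κ := 1 / 2 ^ m)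
        (d := 3 / 2 * 2 ^ m / 2 ^ (2 * r)) h.meas_p h.meas_q h.adapted ⟨by positivity, ?_⟩
        (h.piece_mem hrk (hidx u hu)) (h.piece_mem hrk (hidx v hv)) hHm
        (by positivity) ?_ (by positivity) ?_ ?_
      · rw [div_le_one (by positivity)]; exact_mod_cast hi'.le
      · rw [← add_div]
        gcongr
        have : (u : ℝ) + 2 ^ (m + 1) + 1 ≤ v := by exact_mod_cast huv
        have h2 : (0 : ℝ) < 2 ^ m := by positivity
        push_cast
        rw [pow_succ] at this
        linarith
      · rcases hsep with h' | h'
        · right; linarith [hrt v hv]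
        · left
          rw [add_div] at h'
          have : (0 : ℝ) < 1 / 2 ^ r := by positivity
          linarith [hl u]
      · have h1 : ((2 ^ k : ℝ)⁻¹) ^ 2 ≤ 1 / 2 ^ (2 * r) := by
          rw [hrr, ← one_div, div_pow, one_pow]
          gcongr
          · norm_num
        have h2 : 2 * (1 / 2 ^ m) * (3 / 2 * 2 ^ m / 2 ^ (2 * r)) = 3 * (1 / (2 : ℝ) ^ (2 * r)) := by
          field_simp
        have h3 : 2 * (1 / (2 : ℝ) ^ r) ^ 2 = 2 * (1 / (2 : ℝ) ^ (2 * r)) := by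
          rw [hrr]; field_simp
        rw [h2, h3]; linarith)
  have e2 := energy_nonneg (μ := μ) k F r i'
  have e1 := energy_nonneg (μ := μ) k F s i
  calc mixed μ (piece k F s i) H
      = ∫ x, ‖∑ u ∈ Finset.range (2 ^ d), piece k F (2 * r) (i * 2 ^ d + u) x‖ ^ 2 *
          ‖H x‖ ^ 4 ∂μ := by
        rw [mixed, hsplit]; simp only [Finset.sum_apply]
    _ ≤ (2 * (2 ^ (m + 1) : ℕ) + 1) *
          ∑ u ∈ Finset.range (2 ^ d), mixed μ (piece k F (2 * r) (i * 2 ^ d + u)) H := horth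
    _ ≤ 2 ^ (m + 3) * ∑ u ∈ Finset.range (2 ^ d), Real.sqrt (K * B ^ 3) *
        (energy μ k F (2 * r) (i * 2 ^ d + u) * energy μ k F r i' ^ 2) := by
        gcongr with u hu
        · exact Finset.sum_nonneg fun u _ => mixed_nonneg μ _ _
        · push_cast
          have : (1 : ℝ) ≤ 2 ^ m := one_le_pow₀ (by norm_num)
          rw [pow_add, pow_add]
          linarith
        · exact hterm u hu
    _ = _ := by rw [← Finset.mul_sum, ← Finset.sum_mul, ← hESplit]; ring

variable {E ε : ℝ}

/-- Iterating the congruencing step `n` times. Each step doubles the scale exponent `m 2^j`, takes a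
square root of the constant, and gains `2^(-3 ε m 2^j)` from decoupling at the coarser scale, so
that all steps gain the same amount after the square roots. -/
lemma bilinearBound_iterate (h : ParabolicSum μ p q k F) (hm : 1 ≤ m) (hE : 0 ≤ E) (hε : 0 ≤ ε)
    (hD : ∀ s : ℕ, 1 ≤ s → s ≤ k → Decouples μ (k - s) (E * 2 ^ (-2 * ε * s))) (n : ℕ) :
    ∀ j : ℕ, m * 2 ^ (j + n) ≤ k → ∀ s : ℕ, 1 ≤ s → s ≤ 2 * (m * 2 ^ j) → s ≤ k →
      BilinearBound μ k m F s (m * 2 ^ j)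
        (E ^ 3 * (2 : ℝ) ^ (2 * ((m : ℝ) + 3) - 3 * ε * m * 2 ^ j * n)) := by
  induction n with
  | zero =>
    intro j hj s hs1 _ hsk
    have hr1 : 1 ≤ m * 2 ^ j := Nat.mul_pos hm (by positivity)
    have hle : ∀ s : ℕ, E * (2 : ℝ) ^ (-2 * ε * s) ≤ E := fun s =>
      mul_le_of_le_one_right hE (Real.rpow_le_one_of_one_le_of_nonpos (by norm_num)
        (by nlinarith [mul_nonneg hε (Nat.cast_nonneg (α := ℝ) s)]))
    refine (h.bilinearBound_of_decouples hsk hj hE ((hD s hs1 hsk).mono (hle s))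
      ((hD _ hr1 hj).mono (hle _))).mono ?_
    have : (1 : ℝ) ≤ 2 ^ (2 * ((m : ℝ) + 3) - 3 * ε * m * 2 ^ j * (0 : ℕ)) :=
      Real.one_le_rpow (by norm_num) (by simp; positivity)
    calc E * E ^ 2 = E ^ 3 * 1 := by ring
      _ ≤ _ := by gcongr
  | succ n ih =>
    intro j hj s hs1 hs _
    have hr1 : 1 ≤ m * 2 ^ j := Nat.mul_pos hm (by positivity)
    have h2r : m * 2 ^ (j + 1) = 2 * (m * 2 ^ j) := by ring
    have h2rk : 2 * (m * 2 ^ j) ≤ k := by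
      refine le_trans ?_ hj
      rw [← h2r]
      exact Nat.mul_le_mul_left _ (Nat.pow_le_pow_right (by norm_num) (by omega))
    have hprev := ih (j + 1) (by rwa [add_right_comm]) (m * 2 ^ j) hr1 (by rw [h2r]; omega)
      (by omega)
    rw [h2r] at hprev
    refine (h.bilinearBound_step hs h2rk (by positivity) (by positivity) hprev
      (hD _ hr1 (by omega))).mono (le_of_eq ?_)
    set R : ℝ := m * 2 ^ j with hR
    have hcast : ((m * 2 ^ j : ℕ) : ℝ) = R := by push_cast; rfl
    rw [hcast]
    have hsq : E ^ 3 * (2 : ℝ) ^ (2 * ((m : ℝ) + 3) - 3 * ε * m * 2 ^ (j + 1) * n) *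
        (E * 2 ^ (-2 * ε * R)) ^ 3 =
        (E ^ 3 * (2 : ℝ) ^ (((m : ℝ) + 3) - 3 * ε * R * n - 3 * ε * R)) ^ 2 := by
      rw [mul_pow, mul_pow (E ^ 3), ← Real.rpow_natCast (2 ^ _), ← Real.rpow_mul (by norm_num),
        ← Real.rpow_natCast (2 ^ _), ← Real.rpow_mul (by norm_num)]
      rw [show E ^ 3 * (2 : ℝ) ^ (2 * ((m : ℝ) + 3) - 3 * ε * m * 2 ^ (j + 1) * n) *
        (E ^ 3 * 2 ^ (-2 * ε * R * (3 : ℕ))) = (E ^ 3) ^ 2 *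
        ((2 : ℝ) ^ (2 * ((m : ℝ) + 3) - 3 * ε * m * 2 ^ (j + 1) * n) *
          2 ^ (-2 * ε * R * (3 : ℕ))) by ring, ← Real.rpow_add (by norm_num)]
      congr 2
      rw [hR]; push_cast; ring
    rw [hsq, Real.sqrt_sq (by positivity), ← Real.rpow_natCast 2 (m + 3)]
    rw [mul_left_comm, ← Real.rpow_add (by norm_num)]
    congr 2
    rw [hR]; push_cast; ring

/-- Reduction to the bilinear estimate: `f²` splits into products over pairs of intervals of length
`2^(-m)`, of which at most three per interval are not separated. -/
lemma lpNorm_sq_le_of_bilinearBound (h : ParabolicSum μ p q k F) (hmk : m ≤ k) {A Y : ℝ}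
    (hA0 : 0 ≤ A) (hY : 0 ≤ Y) (hA : Decouples μ (k - m) A)
    (hB : BilinearBound μ k m F m m (Y ^ 3)) :
    lpNorm (∑ l ∈ Finset.range (2 ^ k), F l) 6 μ ^ 2 ≤
      (3 * A + 2 ^ m * Y) * ∑ l ∈ Finset.range (2 ^ k), lpNorm (F l) 6 μ ^ 2 := by
  set M := 2 ^ m with hM
  set f := piece k F m
  set S := energy μ k F m
  have hS0 : ∀ i, 0 ≤ S i := energy_nonneg k F m
  have hf : ∀ i ∈ Finset.range M, BddMeas (f i) := fun i hi =>
    h.bddMeas_piece hmk (Finset.mem_range.1 hi)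
  have hsum : ∑ l ∈ Finset.range (2 ^ k), F l = ∑ i ∈ Finset.range M, f i := by
    have := sum_block_pow F (Nat.zero_le m) hmk 0
    simpa [block_zero, f, piece] using this
  have hSsum : ∑ l ∈ Finset.range (2 ^ k), lpNorm (F l) 6 μ ^ 2 = ∑ i ∈ Finset.range M, S i := by
    have := sum_block_pow (fun l => lpNorm (F l) 6 μ ^ 2) (Nat.zero_le m) hmk 0
    simpa [block_zero, S, energy] using this
  have hpair : ∀ i ∈ Finset.range M, ∀ i' ∈ Finset.range M,
      lpNorm (fun x => f i x * f i' x) 3 μ ≤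
        ((if i ≤ i' + 1 ∧ i' ≤ i + 1 then A else 0) + Y) * ((S i + S i') / 2) := by
    intro i hi i' hi'
    have hSS : 0 ≤ (S i + S i') / 2 := by linarith [hS0 i, hS0 i']
    split_ifs with hc
    · calc _ ≤ lpNorm (f i) 6 μ * lpNorm (f i') 6 μ := lpNorm_three_mul_le μ (hf i hi) (hf i' hi')
        _ ≤ (lpNorm (f i) 6 μ ^ 2 + lpNorm (f i') 6 μ ^ 2) / 2 := by
          nlinarith [sq_nonneg (lpNorm (f i) 6 μ - lpNorm (f i') 6 μ)]
        _ ≤ (A * S i + A * S i') / 2 := by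
          have h1 := h.lpNorm_piece_sq_le hmk (Finset.mem_range.1 hi) hA
          have h2 := h.lpNorm_piece_sq_le hmk (Finset.mem_range.1 hi') hA
          linarith
        _ = (A + 0) * ((S i + S i') / 2) := by ring
        _ ≤ _ := by gcongr
    · have hsep : Separated m m i m i' ∧ Separated m m i' m i := by
        have : i + 2 ≤ i' ∨ i' + 2 ≤ i := by omega
        rw [Separated, Separated, ← add_div, ← add_div]
        rcases this with h' | h'
        · have : ((i : ℝ) + 1 + 1) / 2 ^ m ≤ i' / 2 ^ m := by
            gcongr
            have : (i : ℝ) + 2 ≤ i' := by exact_mod_cast h'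
            linarith
          exact ⟨Or.inl this, Or.inr this⟩
        · have : ((i' : ℝ) + 1 + 1) / 2 ^ m ≤ i / 2 ^ m := by
            gcongr
            have : (i' : ℝ) + 2 ≤ i := by exact_mod_cast h'
            linarith
          exact ⟨Or.inr this, Or.inl this⟩
      have h1 := hB i (Finset.mem_range.1 hi) i' (Finset.mem_range.1 hi') hsep.1
      have h2 := hB i' (Finset.mem_range.1 hi') i (Finset.mem_range.1 hi) hsep.2
      rw [zero_add]
      refine le_of_pow_le_pow_left₀ (n := 6) (by norm_num) (by positivity) ?_
      have hi0 := hS0 i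
      have hi0' := hS0 i'
      calc lpNorm (fun x => f i x * f i' x) 3 μ ^ 6
          = (lpNorm (fun x => f i x * f i' x) 3 μ ^ 3) ^ 2 := by ring
        _ ≤ mixed μ (f i) (f i') * mixed μ (f i') (f i) :=
          lpNorm_three_mul_pow_le μ (hf i hi) (hf i' hi')
        _ ≤ (Y ^ 3 * (S i * S i' ^ 2)) * (Y ^ 3 * (S i' * S i ^ 2)) := by
          have := mixed_nonneg μ (f i') (f i)
          gcongr
        _ = Y ^ 6 * (S i * S i') ^ 3 := by ring
        _ ≤ Y ^ 6 * (((S i + S i') / 2) ^ 2) ^ 3 := by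
          gcongr
          nlinarith [sq_nonneg (S i - S i')]
        _ = _ := by ring
  have hcount : ∀ i, ∑ i' ∈ Finset.range M, (if i ≤ i' + 1 ∧ i' ≤ i + 1 then A else 0) ≤
      3 * A := by
    intro i
    rw [← Finset.sum_filter, Finset.sum_const, nsmul_eq_mul]
    have : ((Finset.range M).filter fun i' => i ≤ i' + 1 ∧ i' ≤ i + 1) ⊆
        Finset.Icc (i - 1) (i + 1) := by
      intro v hv
      simp only [Finset.mem_filter, Finset.mem_Icc] at hv ⊢
      omega
    have h2 := Finset.card_le_card this
    rw [Nat.card_Icc] at h2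
    have h3 : ((Finset.range M).filter fun i' => i ≤ i' + 1 ∧ i' ≤ i + 1).card ≤ 3 := by omega
    gcongr
    exact_mod_cast h3
  rw [hsum, hSsum]
  have hbd : BddMeas (∑ i ∈ Finset.range M, f i) := by
    have := BddMeas.sum hf
    convert this using 1
    ext x; simp
  have hexp : (fun x => (∑ i ∈ Finset.range M, f i) x * (∑ i ∈ Finset.range M, f i) x) =
      ∑ z ∈ Finset.range M ×ˢ Finset.range M, fun x => f z.1 x * f z.2 x := by
    ext x
    simp only [Finset.sum_apply, Finset.sum_mul_sum, Finset.sum_product]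
  rw [lpNorm_six_sq μ hbd, hexp]
  calc _ ≤ ∑ z ∈ Finset.range M ×ˢ Finset.range M, lpNorm (fun x => f z.1 x * f z.2 x) 3 μ := by
        refine lpNorm_sum_le (fun z hz => ?_) (by norm_num)
        rw [Finset.mem_product] at hz
        exact ((hf _ hz.1).mul (hf _ hz.2)).memLp 3 μ
    _ = ∑ i ∈ Finset.range M, ∑ i' ∈ Finset.range M, lpNorm (fun x => f i x * f i' x) 3 μ :=
        Finset.sum_product _ _ _
    _ ≤ ∑ i ∈ Finset.range M, ∑ i' ∈ Finset.range M,
        ((((if i ≤ i' + 1 ∧ i' ≤ i + 1 then A else 0) + Y) * (S i / 2)) +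
          ((if i' ≤ i + 1 ∧ i ≤ i' + 1 then A else 0) + Y) * (S i' / 2)) := by
        refine Finset.sum_le_sum fun i hi => Finset.sum_le_sum fun i' hi' => ?_
        refine (hpair i hi i' hi').trans (le_of_eq ?_)
        simp only [and_comm (a := i' ≤ i + 1)]
        ring
    _ = 2 * ∑ i ∈ Finset.range M, (∑ i' ∈ Finset.range M,
        ((if i ≤ i' + 1 ∧ i' ≤ i + 1 then A else 0) + Y)) * (S i / 2) := by
        conv_lhs => simp only [Finset.sum_add_distrib (f := fun _ => _ * _)]
        conv_lhs => simp only [Finset.sum_add_distrib (f := fun _ => Finset.sum _ _)]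
        rw [Finset.sum_comm (f := fun i i' =>
          ((if i' ≤ i + 1 ∧ i ≤ i' + 1 then A else 0) + Y) * (S i' / 2))]
        simp only [Finset.sum_mul]
        ring
    _ ≤ 2 * ∑ i ∈ Finset.range M, (3 * A + 2 ^ m * Y) * (S i / 2) := by
        gcongr with i hi
        · linarith [hS0 i]
        · rw [Finset.sum_add_distrib, Finset.sum_const, Finset.card_range, nsmul_eq_mul]
          have := hcount i
          have hMc : ((M : ℕ) : ℝ) = 2 ^ m := by rw [hM]; push_cast; rfl
          rw [hMc]
          linarith
    _ = _ := by
        rw [Finset.mul_sum, Finset.mul_sum]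
        exact Finset.sum_congr rfl fun i _ => by ring

end ParabolicSum

/-- Decoupling for adapted measures: with `N = ⌈2/ε⌉`, the constant
`2^(N 2^N) δ^(-2ε)` is admissible for the squared inequality at scale `δ = 2^(-k)`. -/
theorem decouples_of_pos [IsFiniteMeasure μ] {ε : ℝ} (hε : 0 < ε) (hε' : ε < 1 / 100) (k : ℕ) :
    Decouples μ k (2 ^ (⌈2 / ε⌉₊ * 2 ^ ⌈2 / ε⌉₊) * (2 : ℝ) ^ (2 * ε * k)) := by
  set N := ⌈2 / ε⌉₊ with hN
  have hεN : 2 ≤ ε * N := by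
    have := Nat.le_ceil (2 / ε)
    rw [← hN, div_le_iff₀ hε] at this
    linarith
  have hN9 : (200 : ℝ) ≤ N := by nlinarith
  have hN1 : 1 ≤ N := by
    have : (1 : ℝ) ≤ N := by linarith
    exact_mod_cast this
  induction k using Nat.strong_induction_on with
  | _ k ih =>
    rcases lt_or_ge k (N * 2 ^ N) with hk | hk
    · refine (decouples_trivial k).mono ?_
      have h1 : (2 : ℝ) ^ k ≤ 2 ^ (N * 2 ^ N) := pow_le_pow_right₀ (by norm_num) hk.le
      have h2 : (1 : ℝ) ≤ 2 ^ (2 * ε * k) := Real.one_le_rpow (by norm_num) (by positivity)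
      calc (2 : ℝ) ^ k ≤ 2 ^ (N * 2 ^ N) * 1 := by rw [mul_one]; exact h1
        _ ≤ _ := by gcongr
    · intro p q F hF
      set E : ℝ := 2 ^ (N * 2 ^ N) * (2 : ℝ) ^ (2 * ε * k) with hE
      have hE0 : 0 ≤ E := by positivity
      have hD : ∀ s : ℕ, 1 ≤ s → s ≤ k → Decouples μ (k - s) (E * 2 ^ (-2 * ε * s)) := by
        intro s hs1 hsk
        refine (ih (k - s) (by omega)).mono (le_of_eq ?_)
        rw [hE, mul_assoc _ ((2 : ℝ) ^ (2 * ε * k)), ← Real.rpow_add (by norm_num), Nat.cast_sub hsk]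
        congr 2; ring
      have hNk : N ≤ k := le_trans (Nat.le_mul_of_pos_right N (by positivity)) hk
      have hB := hF.bilinearBound_iterate hN1 hE0 hε.le hD N 0 (by simpa using hk) N hN1
        (by simp; omega) hNk
      set y : ℝ := (2 * ((N : ℝ) + 3) - 3 * ε * N * 2 ^ 0 * N) / 3 with hy
      have hY3 : E ^ 3 * (2 : ℝ) ^ (2 * ((N : ℝ) + 3) - 3 * ε * N * 2 ^ 0 * N) =
          (E * 2 ^ y) ^ 3 := by
        rw [mul_pow E, ← Real.rpow_natCast (2 ^ y), ← Real.rpow_mul (by norm_num)]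
        congr 2
        rw [hy]; push_cast; ring
      rw [hY3, pow_zero, mul_one] at hB
      refine (hF.lpNorm_sq_le_of_bilinearBound hNk (by positivity) (by positivity)
        (hD N hN1 hNk) hB).trans ?_
      refine mul_le_mul_of_nonneg_right ?_ (Finset.sum_nonneg fun _ _ => sq_nonneg _)
      have h1 : (2 : ℝ) ^ (-2 * ε * N) ≤ 1 / 8 := by
        calc (2 : ℝ) ^ (-2 * ε * N) ≤ 2 ^ (-3 : ℝ) :=
              Real.rpow_le_rpow_of_exponent_le (by norm_num) (by linarith)
          _ = 1 / 8 := by rw [Real.rpow_neg (by norm_num)]; norm_num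
      have h2 : (2 : ℝ) ^ N * 2 ^ y ≤ 1 / 2 := by
        rw [← Real.rpow_natCast, ← Real.rpow_add (by norm_num)]
        calc (2 : ℝ) ^ ((N : ℝ) + y) ≤ 2 ^ (-1 : ℝ) := by
              refine Real.rpow_le_rpow_of_exponent_le (by norm_num) ?_
              rw [hy, pow_zero]
              nlinarith
          _ = 1 / 2 := by rw [Real.rpow_neg_one]; norm_num
      nlinarith

end Bilinear

/-! ### A nonnegative band-limited kernel -/

section Kernel

open scoped FourierTransform

/-- The tent function `max(0, 1 - |s|)`. -/
def tent (s : ℝ) : ℂ := ((max 0 (1 - |s|) : ℝ) : ℂ)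

lemma continuous_tent : Continuous tent := by unfold tent; fun_prop

lemma tent_eq_zero {s : ℝ} (hs : 1 ≤ |s|) : tent s = 0 := by
  rw [tent, max_eq_left (by linarith), Complex.ofReal_zero]

lemma integrable_tent : Integrable tent := by
  refine continuous_tent.integrable_of_hasCompactSupport ?_
  refine HasCompactSupport.intro (isCompact_Icc (a := (-1 : ℝ)) (b := 1)) fun x hx => ?_
  refine tent_eq_zero (le_of_lt ?_)
  rw [Set.mem_Icc, not_and_or] at hx
  rw [lt_abs]
  rcases hx with h | h
  · right; linarith
  · left; linarith

lemma integral_tent_mul_exp {a : ℂ} (ha : a ≠ 0) :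
    ∫ s : ℝ, Complex.exp (a * s) * tent s =
      (Complex.exp a + Complex.exp (-a) - 2) / a ^ 2 := by
  have hcont : Continuous fun s : ℝ => Complex.exp (a * s) * tent s := by
    have := continuous_tent
    fun_prop
  have h0 : ∫ s : ℝ, Complex.exp (a * s) * tent s =
      ∫ s in (-1 : ℝ)..1, Complex.exp (a * s) * tent s := by
    rw [intervalIntegral.integral_of_le (by norm_num), ← integral_indicator measurableSet_Ioc]
    congr 1; ext s
    by_cases hs : s ∈ Set.Ioc (-1 : ℝ) 1
    · rw [Set.indicator_of_mem hs]
    · rw [Set.indicator_of_notMem hs, tent_eq_zero, mul_zero]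
      rw [Set.mem_Ioc, not_and_or] at hs
      rw [le_abs]
      rcases hs with h | h
      · right; linarith
      · left; linarith
  have hexp : ∀ s : ℝ, HasDerivAt (fun s : ℝ => Complex.exp (a * s)) (Complex.exp (a * s) * a) s :=
    fun s => by simpa using ((Complex.ofRealCLM.hasDerivAt (x := s)).const_mul a).cexp
  have h1 : ∫ s in (-1 : ℝ)..0, Complex.exp (a * s) * tent s =
      1 / a - 1 / a ^ 2 + Complex.exp (-a) / a ^ 2 := by
    rw [intervalIntegral.integral_eq_sub_of_hasDerivAt (f := fun s : ℝ =>
      Complex.exp (a * s) * ((1 + s) / a - 1 / a ^ 2)) (f' := fun s : ℝ =>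
        Complex.exp (a * s) * tent s) ?_ (hcont.intervalIntegrable _ _)]
    · simp; ring
    · intro s hs
      rw [Set.uIcc_of_le (by norm_num)] at hs
      have hlin : HasDerivAt (fun s : ℝ => (1 + (s : ℂ)) / a - 1 / a ^ 2) (1 / a) s := by
        simpa using ((((Complex.ofRealCLM.hasDerivAt (x := s)).const_add 1).div_const a).sub_const
          (1 / a ^ 2))
      refine ((hexp s).mul hlin).congr_deriv ?_
      have ht : tent s = 1 + s := by
        rw [tent, abs_of_nonpos hs.2, max_eq_right (by linarith [hs.1])]; push_cast; ring
      rw [ht]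
      field_simp
      ring
  have h2 : ∫ s in (0 : ℝ)..1, Complex.exp (a * s) * tent s =
      Complex.exp a / a ^ 2 - 1 / a - 1 / a ^ 2 := by
    rw [intervalIntegral.integral_eq_sub_of_hasDerivAt (f := fun s : ℝ =>
      Complex.exp (a * s) * ((1 - s) / a + 1 / a ^ 2)) (f' := fun s : ℝ =>
        Complex.exp (a * s) * tent s) ?_ (hcont.intervalIntegrable _ _)]
    · simp; ring
    · intro s hs
      rw [Set.uIcc_of_le (by norm_num)] at hs
      have hlin : HasDerivAt (fun s : ℝ => (1 - (s : ℂ)) / a + 1 / a ^ 2) (-1 / a) s := by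
        simpa using ((((Complex.ofRealCLM.hasDerivAt (x := s)).const_sub 1).div_const a).add_const
          (1 / a ^ 2))
      refine ((hexp s).mul hlin).congr_deriv ?_
      have ht : tent s = 1 - s := by
        rw [tent, abs_of_nonneg hs.1, max_eq_right (by linarith [hs.2])]; push_cast; ring
      rw [ht]
      field_simp
      ring
  rw [h0, ← intervalIntegral.integral_add_adjacent_intervals (b := 0)
    (hcont.intervalIntegrable _ _) (hcont.intervalIntegrable _ _), h1, h2]
  ring

lemma fourier_tent {w : ℝ} (hw : w ≠ 0) :
    𝓕 tent w = ((Real.sinc (Real.pi * w) ^ 2 : ℝ) : ℂ) := by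
  have hpw : Real.pi * w ≠ 0 := mul_ne_zero Real.pi_ne_zero hw
  have hwC : (w : ℂ) ≠ 0 := by exact_mod_cast hw
  have hpi : (Real.pi : ℂ) ≠ 0 := by exact_mod_cast Real.pi_ne_zero
  have ha : (-2 * Real.pi * w * Complex.I : ℂ) ≠ 0 := by
    simp [Real.pi_ne_zero, hw, Complex.I_ne_zero]
  rw [Real.fourier_real_eq_integral_exp_smul]
  have : ∀ s : ℝ, Complex.exp (↑(-2 * Real.pi * s * w) * Complex.I) • tent s =
      Complex.exp ((-2 * Real.pi * w * Complex.I : ℂ) * s) * tent s := by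
    intro s
    rw [smul_eq_mul]; congr 2; push_cast; ring
  simp_rw [this]
  rw [integral_tent_mul_exp ha, Real.sinc_of_ne_zero hpw]
  push_cast
  rw [Complex.sin]
  have e1 : Complex.exp (-2 * Real.pi * w * Complex.I) =
      Complex.exp (-(Real.pi * w) * Complex.I) ^ 2 := by
    rw [← Complex.exp_nat_mul]; congr 1; push_cast; ring
  have e2 : Complex.exp (-(-2 * Real.pi * w * Complex.I)) =
      Complex.exp ((Real.pi * w) * Complex.I) ^ 2 := by
    rw [← Complex.exp_nat_mul]; congr 1; push_cast; ring
  have e3 : Complex.exp (-(Real.pi * w) * Complex.I) * Complex.exp ((Real.pi * w) * Complex.I) =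
      1 := by
    rw [← Complex.exp_add]; simp
  rw [e1, e2]
  have hI := Complex.I_sq
  rw [div_pow, div_pow, mul_pow, mul_pow, mul_pow, mul_pow, hI]
  generalize Complex.exp (-(Real.pi * w) * Complex.I) = A at *
  generalize Complex.exp ((Real.pi * w) * Complex.I) = B at *
  field_simp
  linear_combination (-2 : ℂ) * e3

lemma abs_sinc_pi_le (x : ℝ) : |Real.sinc (Real.pi * x)| ≤ 2 / (1 + |x|) := by
  rw [le_div_iff₀ (by positivity)]
  have h1 := Real.abs_sinc_le_one (Real.pi * x)
  have h2 : |Real.sinc (Real.pi * x)| * |x| ≤ 1 := by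
    rcases eq_or_ne x 0 with rfl | hx
    · simp
    · have hx' : 0 < |x| := abs_pos.2 hx
      have hp := Real.pi_gt_three
      rw [Real.sinc_of_ne_zero (mul_ne_zero Real.pi_ne_zero hx), abs_div, abs_mul,
        abs_of_pos Real.pi_pos, div_mul_eq_mul_div, div_le_one (by positivity)]
      have := Real.abs_sin_le_one (Real.pi * x)
      nlinarith
  linarith

lemma integrable_sinc_pow (n : ℕ) :
    Integrable fun x : ℝ => ((Real.sinc (Real.pi * x) ^ (n + 2) : ℝ) : ℂ) := by
  refine Integrable.ofReal ?_
  have hb : Integrable fun x : ℝ => 4 * (1 + ‖x‖) ^ (-2 : ℝ) :=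
    (integrable_one_add_norm (by simp)).const_mul 4
  have hcont : Continuous fun x : ℝ => Real.sinc (Real.pi * x) ^ (n + 2) :=
    (Real.continuous_sinc.comp (continuous_const_mul Real.pi)).pow (n + 2)
  refine hb.mono' hcont.aestronglyMeasurable
    (Filter.Eventually.of_forall fun x => ?_)
  change ‖Real.sinc (Real.pi * x) ^ (n + 2)‖ ≤ _
  rw [norm_pow, Real.norm_eq_abs, pow_add, Real.norm_eq_abs]
  have h1 : |Real.sinc (Real.pi * x)| ^ n ≤ 1 :=
    pow_le_one₀ (abs_nonneg _) (Real.abs_sinc_le_one _)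
  have h2 := pow_le_pow_left₀ (abs_nonneg _) (abs_sinc_pi_le x) 2
  have h3 : (2 / (1 + |x|)) ^ 2 = 4 * (1 + |x|) ^ (-2 : ℝ) := by
    rw [Real.rpow_neg (by positivity), Real.rpow_two, div_pow]; norm_num [div_eq_mul_inv]
  rw [← h3]
  calc _ ≤ 1 * |Real.sinc (Real.pi * x)| ^ 2 := by gcongr
    _ ≤ _ := by rwa [one_mul]

lemma integral_sinc_sq_mul_e {w : ℝ} (hw : 1 < |w|) :
    ∫ x : ℝ, ((Real.sinc (Real.pi * x) ^ 2 : ℝ) : ℂ) * e (w * x) = 0 := by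
  have hae : 𝓕 tent =ᵐ[volume] fun x => ((Real.sinc (Real.pi * x) ^ 2 : ℝ) : ℂ) := by
    filter_upwards [compl_mem_ae_iff.2 (Real.volume_singleton (a := 0))] with x hx
    exact fourier_tent hx
  have hint : Integrable (𝓕 tent) := (integrable_sinc_pow 0).congr hae.symm
  have h := congrFun (continuous_tent.fourierInv_fourier_eq integrable_tent hint) w
  rw [tent_eq_zero hw.le, Real.fourierInv_eq'] at h
  rw [← h]
  refine integral_congr_ae ?_
  filter_upwards [hae] with x hx
  rw [hx, smul_eq_mul, mul_comm, e]
  congr 2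
  simp only [RCLike.inner_apply, conj_trivial]
  push_cast; ring

lemma sinc_eq_integral (x : ℝ) :
    ((Real.sinc (Real.pi * x) : ℝ) : ℂ) = ∫ s in (-(1 / 2) : ℝ)..(1 / 2), e (s * x) := by
  rcases eq_or_ne x 0 with rfl | hx
  · simp [e_zero]; norm_num
  have hc : (2 * Real.pi * Complex.I * x : ℂ) ≠ 0 := by
    simp [Real.pi_ne_zero, hx, Complex.I_ne_zero]
  have h := integral_exp_mul_complex (a := -(1 / 2)) (b := 1 / 2) hc
  have h2 : ∀ s : ℝ, e (s * x) = Complex.exp (2 * Real.pi * Complex.I * x * s) := by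
    intro s; rw [e]; congr 1; push_cast; ring
  simp_rw [h2]
  rw [h, Real.sinc_of_ne_zero (mul_ne_zero Real.pi_ne_zero hx)]
  push_cast
  rw [Complex.sin]
  have hx' : (x : ℂ) ≠ 0 := by exact_mod_cast hx
  have hpi : (Real.pi : ℂ) ≠ 0 := by exact_mod_cast Real.pi_ne_zero
  rw [show (2 * Real.pi * Complex.I * x * (1 / 2) : ℂ) = Real.pi * x * Complex.I by ring,
    show (2 * Real.pi * Complex.I * x * -(1 / 2) : ℂ) = -(Real.pi * x) * Complex.I by ring]
  have hI := Complex.I_sq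
  field_simp
  rw [hI]; ring

/-- Each further factor `sinc(πx)` is an average of the characters `e(sx)`, `|s| ≤ 1/2`, so it
widens the frequency support by `1/2`. -/
lemma integral_sinc_pow_mul_e (n : ℕ) : ∀ w : ℝ, (n + 2 : ℝ) / 2 < |w| →
    ∫ x : ℝ, ((Real.sinc (Real.pi * x) ^ (n + 2) : ℝ) : ℂ) * e (w * x) = 0 := by
  induction n with
  | zero => intro w hw; exact integral_sinc_sq_mul_e (by simpa using hw)
  | succ n ih =>
    intro w hw
    set G : ℝ → ℂ := fun x => ((Real.sinc (Real.pi * x) ^ (n + 2) : ℝ) : ℂ) with hG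
    have hexp : ∀ x : ℝ, ((Real.sinc (Real.pi * x) ^ (n + 1 + 2) : ℝ) : ℂ) * e (w * x) =
        ∫ s in (-(1 / 2) : ℝ)..(1 / 2), G x * e ((w + s) * x) := by
      intro x
      rw [intervalIntegral.integral_const_mul]
      have : ∀ s : ℝ, e ((w + s) * x) = e (w * x) * e (s * x) := fun s => by
        rw [← e_add]; congr 1; ring
      simp_rw [this]
      rw [intervalIntegral.integral_const_mul, ← sinc_eq_integral, hG]
      push_cast; ring
    simp_rw [hexp]
    rw [← intervalIntegral_integral_swap]
    · rw [intervalIntegral.integral_of_le (by norm_num)]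
      refine setIntegral_eq_zero_of_forall_eq_zero fun s hs => ih _ ?_
      have h1 : |s| ≤ 1 / 2 := abs_le.2 ⟨hs.1.le, hs.2⟩
      have h2 : |w| ≤ |w + s| + |s| := by
        have := abs_sub (w + s) s
        rwa [add_sub_cancel_right] at this
      push_cast at hw
      linarith
    · have : IsFiniteMeasure (volume.restrict (Set.uIoc (-(1 / 2) : ℝ) (1 / 2))) := by
        rw [Set.uIoc_of_le (by norm_num)]; infer_instance
      have h1 : Integrable (fun z : ℝ × ℝ => G z.2)
          ((volume.restrict (Set.uIoc (-(1 / 2) : ℝ) (1 / 2))).prod volume) :=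
        (integrable_sinc_pow n).comp_snd _
      have h2 : Continuous fun z : ℝ × ℝ => e ((w + z.1) * z.2) :=
        continuous_e.comp (by fun_prop)
      have := h1.bdd_mul (c := 1) h2.aestronglyMeasurable
        (Filter.Eventually.of_forall fun z => (norm_e _).le)
      refine this.congr (Filter.Eventually.of_forall fun z => ?_)
      simp only [Function.uncurry]
      rw [mul_comm]

/-- The kernel `sinc(πx)^100`: nonnegative, with decay of order `100`, and with Fourier transform
supported in `[-50, 50]`. -/
def kern (x : ℝ) : ℝ := Real.sinc (Real.pi * x) ^ 100

lemma kern_nonneg (x : ℝ) : 0 ≤ kern x := Even.pow_nonneg (by decide) _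

lemma continuous_kern : Continuous kern :=
  (Real.continuous_sinc.comp (by fun_prop)).pow _

lemma kern_le (x : ℝ) : kern x ≤ (2 / (1 + |x|)) ^ 100 := by
  rw [kern, ← Even.pow_abs (by decide)]
  exact pow_le_pow_left₀ (abs_nonneg _) (abs_sinc_pi_le x) 100

lemma le_kern {x : ℝ} (hx : |x| ≤ 1 / 2) : (1 / 2) ^ 100 ≤ kern x := by
  refine pow_le_pow_left₀ (by norm_num) ?_ 100
  have key : ∀ y : ℝ, 0 ≤ y → y ≤ 1 / 2 → 1 / 2 ≤ Real.sinc (Real.pi * y) := by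
    intro y hy0 hy
    rcases hy0.eq_or_lt with rfl | hy0
    · simp; norm_num
    · have hp := Real.pi_pos
      rw [Real.sinc_of_ne_zero (by positivity), le_div_iff₀ (by positivity)]
      have := Real.mul_le_sin (x := Real.pi * y) (by positivity) (by nlinarith)
      have h2 : 2 / Real.pi * (Real.pi * y) = 2 * y := by field_simp
      nlinarith [Real.pi_le_four]
  rcases le_total 0 x with h | h
  · exact key x h (by rwa [abs_of_nonneg h] at hx)
  · rw [← Real.sinc_neg, ← mul_neg]
    exact key (-x) (by linarith) (by rwa [abs_of_nonpos h] at hx)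

lemma integrable_kern : Integrable fun x => (kern x : ℂ) := integrable_sinc_pow 98

lemma integral_kern_mul_e {w : ℝ} (hw : 50 < |w|) : ∫ x : ℝ, (kern x : ℂ) * e (w * x) = 0 :=
  integral_sinc_pow_mul_e 98 w (by norm_num; exact hw)

lemma integral_kern_comp_mul_e {a c b : ℝ} (ha : 0 < a) (hb : 50 * a < |b|) :
    ∫ x : ℝ, (kern (a * (x - c)) : ℂ) * e (b * x) = 0 := by
  have h1 : ∀ x : ℝ, (kern (a * (x - c)) : ℂ) * e (b * x) =
      (fun z => (kern z : ℂ) * e (b / a * z) * e (b * c)) (a * (x - c)) := by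
    intro x
    simp only
    rw [mul_assoc, ← e_add]
    congr 2; field_simp; ring
  simp_rw [h1]
  rw [integral_sub_right_eq_self (fun y => (fun z => (kern z : ℂ) * e (b / a * z) * e (b * c))
    (a * y)) c, Measure.integral_comp_mul_left
      (fun z => (kern z : ℂ) * e (b / a * z) * e (b * c)), integral_mul_const, integral_kern_mul_e, zero_mul,
    smul_zero]
  rw [abs_div, abs_of_pos ha, lt_div_iff₀ ha]; exact hb

end Kernel

/-! ### The extension operator as a limit of trigonometric sums -/

section Limits

open Filter Topology

variable {X : Type*} [MeasurableSpace X] {μ : Measure X}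

lemma tendsto_lpNorm_six [IsFiniteMeasure μ] {A : ℕ → X → ℂ} {f : X → ℂ} {C : ℝ}
    (hA : ∀ M, Measurable (A M)) (hC : ∀ M x, ‖A M x‖ ≤ C)
    (hlim : ∀ x, Tendsto (fun M => A M x) atTop (𝓝 (f x))) :
    BddMeas f ∧ Tendsto (fun M => lpNorm (A M) 6 μ) atTop (𝓝 (lpNorm f 6 μ)) := by
  have hf : BddMeas f := ⟨measurable_of_tendsto_metrizable hA (tendsto_pi_nhds.2 hlim), C,
    fun x => le_of_tendsto (hlim x).norm (Eventually.of_forall fun M => hC M x)⟩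
  have hroot : ∀ g : X → ℂ, BddMeas g →
      lpNorm g 6 μ = (∫ x, ‖g x‖ ^ 6 ∂μ) ^ ((6 : ℕ) : ℝ)⁻¹ := fun g hg => by
    rw [← lpNorm_six_pow μ hg, Real.pow_rpow_inv_natCast lpNorm_nonneg (by norm_num)]
  refine ⟨hf, ?_⟩
  simp_rw [fun M => hroot (A M) ⟨hA M, C, hC M⟩]
  rw [hroot f hf]
  refine Tendsto.rpow_const ?_ (Or.inr (by norm_num))
  refine tendsto_integral_of_dominated_convergence (fun _ => C ^ 6)
    (fun M => ((hA M).norm.pow_const 6).aestronglyMeasurable) (integrable_const _) ?_ ?_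
  · intro M
    filter_upwards with x
    rw [norm_pow, norm_norm]
    exact pow_le_pow_left₀ (norm_nonneg _) (hC M x) 6
  · filter_upwards with x using (hlim x).norm.pow 6

/-- A decoupling inequality passes to bounded pointwise limits of trigonometric sums. -/
lemma Decouples.of_tendsto [IsFiniteMeasure μ] {k : ℕ} {K : ℝ} (h : Decouples μ k K)
    {p q : X → ℝ} {A : ℕ → ℕ → X → ℂ} {f : ℕ → X → ℂ} {C : ℕ → ℝ}
    (hA : ∀ M, ParabolicSum μ p q k (A M)) (hC : ∀ M, ∀ l < 2 ^ k, ∀ x, ‖A M l x‖ ≤ C l)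
    (hlim : ∀ l < 2 ^ k, ∀ x, Tendsto (fun M => A M l x) atTop (𝓝 (f l x))) :
    lpNorm (∑ l ∈ Finset.range (2 ^ k), f l) 6 μ ^ 2 ≤
      K * ∑ l ∈ Finset.range (2 ^ k), lpNorm (f l) 6 μ ^ 2 := by
  have hbm : ∀ M, ∀ l < 2 ^ k, BddMeas (A M l) := fun M l hl =>
    bddMeas_of_mem_trig (hA M).meas_p (hA M).meas_q ((hA M).mem l hl)
  have h1 := (tendsto_lpNorm_six (μ := μ) (A := fun M => ∑ l ∈ Finset.range (2 ^ k), A M l)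
    (f := ∑ l ∈ Finset.range (2 ^ k), f l) (C := ∑ l ∈ Finset.range (2 ^ k), C l) (fun M => by
        have := Finset.measurable_sum (Finset.range (2 ^ k)) (f := A M)
          fun l hl => (hbm M l (Finset.mem_range.1 hl)).meas
        convert this using 1
        ext x; simp) (fun M x => by
        rw [Finset.sum_apply]
        exact norm_sum_le_of_le _ fun l hl => hC M l (Finset.mem_range.1 hl) x) (fun x => by
        simp only [Finset.sum_apply]
        exact tendsto_finsetSum _ fun l hl => hlim l (Finset.mem_range.1 hl) x)).2
  have h2 : Tendsto (fun M => K * ∑ l ∈ Finset.range (2 ^ k), lpNorm (A M l) 6 μ ^ 2) atTop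
      (𝓝 (K * ∑ l ∈ Finset.range (2 ^ k), lpNorm (f l) 6 μ ^ 2)) :=
    (tendsto_finsetSum _ fun l hl => ((tendsto_lpNorm_six
      (fun M => (hbm M l (Finset.mem_range.1 hl)).meas)
      (fun M => hC M l (Finset.mem_range.1 hl))
      (hlim l (Finset.mem_range.1 hl))).2.pow 2)).const_mul K
  exact le_of_tendsto_of_tendsto' (h1.pow 2) h2 fun M => h p q (A M) (hA M)

/-- Replacing `ξ` in the phase by simple functions `s M → ξ` with values in `J` exhibits `E_J g`
as a limit of trigonometric sums with frequencies over `J`. -/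
lemma exists_tendsto_extOp {a b : ℝ} (hab : a ≤ b) {g : ℝ → ℂ}
    (hg : IntegrableOn g (Set.Icc a b)) :
    ∃ A : ℕ → Plane → ℂ, (∀ M, A M ∈ trig (fun x => x 0) (fun x => x 1) (arc a b)) ∧
      (∀ M x, ‖A M x‖ ≤ ∫ ξ in Set.Icc a b, ‖g ξ‖) ∧
      ∀ x, Tendsto (fun M => A M x) atTop (𝓝 (extOp (Set.Icc a b) g x)) := by
  have ha : a ∈ Set.Icc a b := Set.left_mem_Icc.2 hab
  set s : ℕ → SimpleFunc ℝ ℝ := SimpleFunc.approxOn id measurable_id (Set.Icc a b) a ha with hs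
  have hmeas : ∀ (M : ℕ) (x : Plane), Measurable fun ξ : ℝ => e (s M ξ * x 0 + s M ξ ^ 2 * x 1) :=
    fun M x => continuous_e.measurable.comp
      (((s M).measurable.mul_const _).add (((s M).measurable.pow_const 2).mul_const _))
  refine ⟨fun M x => ∫ ξ in Set.Icc a b, g ξ * e (s M ξ * x 0 + s M ξ ^ 2 * x 1), ?_, ?_, ?_⟩
  · intro M
    have hfun : (fun x : Plane => ∫ ξ in Set.Icc a b, g ξ * e (s M ξ * x 0 + s M ξ ^ 2 * x 1)) =
        ∑ v ∈ (s M).range, (∫ ξ in Set.Icc a b, (s M ⁻¹' {v}).indicator g ξ) •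
          char (fun x : Plane => x 0) (fun x => x 1) (v, v ^ 2) := by
      ext x
      simp only [Finset.sum_apply, Pi.smul_apply, smul_eq_mul]
      simp_rw [← integral_mul_const]
      rw [← integral_finsetSum]
      · refine integral_congr_ae (Eventually.of_forall fun ξ => ?_)
        beta_reduce
        rw [Finset.sum_eq_single (s M ξ)]
        · rw [Set.indicator_of_mem (by simp), char]
        · intro v _ hv
          rw [Set.indicator_of_notMem (by simpa using hv.symm), zero_mul]
        · intro h
          exact absurd ((s M).mem_range_self ξ) h
      · intro v _
        exact (hg.indicator ((s M).measurableSet_fiber v)).mul_const _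
    beta_reduce
    rw [hfun]
    refine Submodule.sum_mem _ fun v hv => Submodule.smul_mem _ _ (char_mem_trig ⟨v, ?_, rfl⟩)
    obtain ⟨ξ, rfl⟩ := SimpleFunc.mem_range.1 hv
    exact SimpleFunc.approxOn_mem measurable_id ha M ξ
  · intro M x
    refine (norm_integral_le_integral_norm _).trans (le_of_eq ?_)
    simp only [norm_mul, norm_e, mul_one]
  · intro x
    refine tendsto_integral_of_dominated_convergence (fun ξ => ‖g ξ‖)
      (fun M => hg.1.mul (hmeas M x).aestronglyMeasurable) hg.norm ?_ ?_
    · intro M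
      filter_upwards with ξ
      simp [norm_e]
    · filter_upwards [ae_restrict_mem measurableSet_Icc] with ξ hξ
      have h1 : Tendsto (fun M => s M ξ) atTop (𝓝 ξ) :=
        SimpleFunc.tendsto_approxOn measurable_id ha (subset_closure hξ)
      exact ((continuous_e.tendsto _).comp
        ((h1.mul_const _).add ((h1.pow 2).mul_const _))).const_mul _

end Limits

/-! ### A measure on the plane adapted to a square -/

section PlaneMeasure

/-- A band-limited substitute for the indicator function of a square with centre `c` and side
length of order `1 / a`. -/
def planeKern (c : Plane) (a : ℝ) (x : Plane) : ℝ :=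
  ∏ i, kern (a * (x i - c i))

/-- The measure with density `planeKern c a`. -/
def planeMeasure (c : Plane) (a : ℝ) : Measure Plane :=
  volume.withDensity fun x => ENNReal.ofReal (planeKern c a x)

lemma planeKern_nonneg (c : Plane) (a : ℝ) (x : Plane) : 0 ≤ planeKern c a x :=
  Finset.prod_nonneg fun _ _ => kern_nonneg _

lemma continuous_planeKern (c : Plane) (a : ℝ) : Continuous (planeKern c a) := by
  have := continuous_kern
  unfold planeKern
  fun_prop

lemma integral_plane_prod (f : Fin 2 → ℝ → ℂ) :
    ∫ x : Plane, ∏ i, f i (x i) = ∏ i, ∫ y, f i y := by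
  rw [← integral_fintype_prod_volume_eq_prod]
  exact (EuclideanSpace.volume_preserving_symm_measurableEquiv_toLp (Fin 2)).integral_comp'
    (fun y : Fin 2 → ℝ => ∏ i, f i (y i))

lemma integrable_planeKern (c : Plane) {a : ℝ} (ha : a ≠ 0) : Integrable (planeKern c a) := by
  have h1 : Integrable kern := by simpa using integrable_kern.re
  have h2 : Integrable (fun y : Fin 2 → ℝ => ∏ i, kern (a * (y i - c i))) :=
    Integrable.fintype_prod (f := fun i y => kern (a * (y - c i)))
      fun i => (h1.comp_mul_left' ha).comp_sub_right (c i)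
  exact (EuclideanSpace.volume_preserving_symm_measurableEquiv_toLp (Fin 2)).integrable_comp_of_integrable h2

lemma isFiniteMeasure_planeMeasure (c : Plane) {a : ℝ} (ha : a ≠ 0) :
    IsFiniteMeasure (planeMeasure c a) :=
  isFiniteMeasure_withDensity_ofReal (integrable_planeKern c ha).2

lemma adapted_planeMeasure (c : Plane) {a lam δ : ℝ} (ha : 0 < a) (hlam : 1 ≤ lam)
    (hδ : 150 * a ≤ δ ^ 2) :
    Adapted (planeMeasure c a) (fun x => lam * x 0) (fun x => lam ^ 2 * x 1) δ := by
  intro w t ht hw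
  have hfreq : 50 * a < |w.1 * lam| ∨ 50 * a < |w.2 * lam ^ 2| := by
    by_contra! hcon
    obtain ⟨h1, h2⟩ := hcon
    rw [abs_mul, abs_of_pos (by linarith : 0 < lam)] at h1
    rw [abs_mul, abs_of_pos (by positivity : 0 < lam ^ 2)] at h2
    have h1' : |w.1| ≤ 50 * a := le_trans (le_mul_of_one_le_right (abs_nonneg _) hlam) h1
    have h2' : |w.2| ≤ 50 * a :=
      le_trans (le_mul_of_one_le_right (abs_nonneg _) (one_le_pow₀ hlam)) h2
    have h3 : |w.2 - 2 * t * w.1| ≤ |w.2| + |2 * t * w.1| := abs_sub _ _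
    rw [abs_mul, abs_of_nonneg (by linarith [ht.1] : 0 ≤ 2 * t)] at h3
    have h4 : 2 * t * |w.1| ≤ 2 * 1 * (50 * a) := by
      have := ht.2
      have := ht.1
      gcongr
    linarith
  set b : Fin 2 → ℝ := ![w.1 * lam, w.2 * lam ^ 2] with hb
  have hprod : ∫ x, char (fun x : Plane => lam * x 0) (fun x => lam ^ 2 * x 1) w x
      ∂(planeMeasure c a) = ∏ i, ∫ y : ℝ, (kern (a * (y - c i)) : ℂ) * e (b i * y) := by
    rw [planeMeasure, integral_withDensity_eq_integral_toReal_smul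
      ((continuous_planeKern c a).measurable.ennreal_ofReal)
      (Filter.Eventually.of_forall fun x => ENNReal.ofReal_lt_top), ← integral_plane_prod]
    congr 1; ext x
    rw [ENNReal.toReal_ofReal (planeKern_nonneg c a x), planeKern]
    simp only [Fin.prod_univ_two, char, hb, Matrix.cons_val_zero, Matrix.cons_val_one,
      Complex.real_smul]
    rw [show w.1 * (lam * x 0) + w.2 * (lam ^ 2 * x 1) =
      w.1 * lam * x 0 + w.2 * lam ^ 2 * x 1 by ring, e_add]
    push_cast; ring
  rw [hprod]
  rcases hfreq with h | h
  · exact Finset.prod_eq_zero (Finset.mem_univ 0) (integral_kern_comp_mul_e ha (by simpa [hb] using h))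
  · exact Finset.prod_eq_zero (Finset.mem_univ 1) (integral_kern_comp_mul_e ha (by simpa [hb] using h))

lemma measurableSet_square (c : Plane) (R : ℝ) : MeasurableSet (square c R) := by
  rw [square, Set.ofPred_forall]
  refine MeasurableSet.iInter fun i => IsClosed.measurableSet (isClosed_le ?_ continuous_const)
  fun_prop

lemma restrict_square_le (c : Plane) {R : ℝ} (hR : 0 < R) :
    volume.restrict (square c R) ≤ (2 : ENNReal) ^ 200 • planeMeasure c (1 / (600 * R)) := by
  rw [planeMeasure, ← withDensity_smul _
    ((continuous_planeKern c _).measurable.ennreal_ofReal), ← withDensity_one (μ := volume.restrict _),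
    ← withDensity_indicator (measurableSet_square c R)]
  refine withDensity_mono (Filter.Eventually.of_forall fun x => ?_)
  by_cases hx : x ∈ square c R
  · rw [Set.indicator_of_mem hx]
    simp only [Pi.one_apply, Pi.smul_apply, smul_eq_mul]
    have hk : ∀ i, (1 / 2 : ℝ) ^ 100 ≤ kern (1 / (600 * R) * (x i - c i)) := fun i => by
      refine le_kern ?_
      rw [abs_mul, abs_of_pos (by positivity), one_div_mul_eq_div, div_le_iff₀ (by positivity)]
      have := hx i
      linarith
    have hK : (1 / 2 : ℝ) ^ 200 ≤ planeKern c (1 / (600 * R)) x := by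
      rw [planeKern, Fin.prod_univ_two]
      calc (1 / 2 : ℝ) ^ 200 = (1 / 2) ^ 100 * (1 / 2) ^ 100 := by rw [← pow_add]
        _ ≤ _ := mul_le_mul (hk 0) (hk 1) (by positivity) (kern_nonneg _)
    have h2 : (2 : ENNReal) ^ 200 = ENNReal.ofReal (2 ^ 200) := by
      rw [ENNReal.ofReal_pow (by norm_num), ENNReal.ofReal_ofNat]
    rw [h2, ← ENNReal.ofReal_mul (by positivity), ENNReal.one_le_ofReal]
    calc (1 : ℝ) = 2 ^ 200 * (1 / 2) ^ 200 := by rw [← mul_pow]; norm_num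
      _ ≤ _ := by gcongr
  · rw [Set.indicator_of_notMem hx]
    exact zero_le

lemma planeKern_le_weight (c : Plane) {R : ℝ} (hR : 0 < R) (x : Plane) :
    planeKern c (1 / (600 * R)) x ≤ 2400 ^ 100 * weight c R x := by
  set y := x - c with hy
  have hk : ∀ i, kern (1 / (600 * R) * (x i - c i)) ≤ (2 / (1 + |y i| / (600 * R))) ^ 100 :=
    fun i => by
      refine (kern_le _).trans (le_of_eq ?_)
      rw [abs_mul, abs_of_pos (by positivity), one_div_mul_eq_div]
      simp [hy]
  rw [planeKern, Fin.prod_univ_two, weight, ← hy]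
  calc _ ≤ (2 / (1 + |y 0| / (600 * R))) ^ 100 * (2 / (1 + |y 1| / (600 * R))) ^ 100 :=
        mul_le_mul (hk 0) (hk 1) (kern_nonneg _) (by positivity)
    _ = (4 / ((1 + |y 0| / (600 * R)) * (1 + |y 1| / (600 * R)))) ^ 100 := by
        rw [← mul_pow, div_mul_div_comm]; norm_num
    _ ≤ (2400 / (1 + ‖y‖ / R)) ^ 100 := by
        refine pow_le_pow_left₀ (by positivity) ?_ 100
        rw [div_le_div_iff₀ (by positivity) (by positivity)]
        have hn : ‖y‖ ≤ |y 0| + |y 1| := by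
          rw [EuclideanSpace.norm_eq, Fin.sum_univ_two]
          refine Real.sqrt_le_iff.2 ⟨by positivity, ?_⟩
          simp only [Real.norm_eq_abs]
          nlinarith [mul_nonneg (abs_nonneg (y 0)) (abs_nonneg (y 1))]
        have h0 : 0 ≤ |y 0| / (600 * R) := by positivity
        have h1 : 0 ≤ |y 1| / (600 * R) := by positivity
        have h2 : ‖y‖ / R ≤ 600 * (|y 0| / (600 * R) + |y 1| / (600 * R)) := by
          rw [← add_div, mul_div_assoc', mul_div_mul_left _ _ (by norm_num)]
          gcongr
        nlinarith [mul_nonneg h0 h1]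
    _ = _ := by rw [div_pow, div_eq_mul_inv]

lemma planeMeasure_le (c : Plane) {R : ℝ} (hR : 0 < R) :
    planeMeasure c (1 / (600 * R)) ≤ (2400 : ENNReal) ^ 100 •
      volume.withDensity fun x => ENNReal.ofReal (weight c R x) := by
  have hw : Measurable fun x => ENNReal.ofReal (weight c R x) := by
    unfold weight
    fun_prop
  rw [planeMeasure, ← withDensity_smul _ hw]
  refine withDensity_mono (Filter.Eventually.of_forall fun x => ?_)
  simp only [Pi.smul_apply, smul_eq_mul]
  have h2 : (2400 : ENNReal) ^ 100 = ENNReal.ofReal (2400 ^ 100) := by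
    rw [ENNReal.ofReal_pow (by norm_num), ENNReal.ofReal_ofNat]
  rw [h2, ← ENNReal.ofReal_mul (by positivity)]
  exact ENNReal.ofReal_le_ofReal (planeKern_le_weight c hR x)

lemma eLpNorm_six_le_of_le_smul {X : Type*} [MeasurableSpace X] {μ ν : Measure X} {C : ENNReal}
    (hC : 1 ≤ C) (h : μ ≤ C • ν) (f : X → ℂ) : eLpNorm f 6 μ ≤ C * eLpNorm f 6 ν := by
  refine (eLpNorm_mono_measure f h).trans ?_
  rw [eLpNorm_smul_measure_of_ne_top (by norm_num), smul_eq_mul]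
  gcongr
  calc C ^ (1 / (6 : ENNReal)).toReal ≤ C ^ (1 : ℝ) :=
        ENNReal.rpow_le_rpow_of_exponent_le hC (by norm_num)
    _ = C := ENNReal.rpow_one C

end PlaneMeasure

/-! ### Transfer to the decoupling constant -/

section Transfer

lemma integrableOn_mul_e {g : ℝ → ℂ} {J : Set ℝ} (hg : IntegrableOn g J) (x : Plane) :
    IntegrableOn (fun ξ => g ξ * e (ξ * x 0 + ξ ^ 2 * x 1)) J := by
  have hc : Continuous fun ξ : ℝ => e (ξ * x 0 + ξ ^ 2 * x 1) := continuous_e.comp (by fun_prop)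
  exact hg.mul_bdd (c := 1) hc.aestronglyMeasurable
    (Filter.Eventually.of_forall fun ξ => (norm_e _).le)

lemma extOp_eq_sum_cap {n : ℕ} (hn : 0 < n) {g : ℝ → ℂ} (hg : IntegrableOn g (Set.Icc 0 1)) :
    extOp (Set.Icc 0 1) g = ∑ l ∈ Finset.range n, extOp (cap (n : ℝ)⁻¹ l) g := by
  have hn' : (0 : ℝ) < n := by exact_mod_cast hn
  ext x
  have hint := integrableOn_mul_e hg x
  simp only [Finset.sum_apply, extOp, cap]
  have hsum := intervalIntegral.sum_integral_adjacent_intervals (μ := volume) (n := n)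
    (f := fun ξ => g ξ * e (ξ * x 0 + ξ ^ 2 * x 1)) (a := fun l : ℕ => l * (n : ℝ)⁻¹) (by
      intro l hl
      rw [intervalIntegrable_iff_integrableOn_Icc_of_le (by push_cast; gcongr; linarith)]
      refine hint.mono_set (Set.Icc_subset_Icc (by positivity) ?_)
      rw [← div_eq_mul_inv, div_le_one hn']
      exact_mod_cast hl)
  simp only [Nat.cast_zero, zero_mul, mul_inv_cancel₀ hn'.ne'] at hsum
  rw [integral_Icc_eq_integral_Ioc, ← intervalIntegral.integral_of_le zero_le_one, ← hsum]
  refine Finset.sum_congr rfl fun l _ => ?_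
  rw [integral_Icc_eq_integral_Ioc, ← intervalIntegral.integral_of_le (by gcongr; linarith)]
  push_cast
  rfl

lemma cap_subset {n l : ℕ} (hl : l < n) : cap (n : ℝ)⁻¹ l ⊆ Set.Icc 0 1 := by
  have hn' : (0 : ℝ) < n := by exact_mod_cast (Nat.zero_lt_of_lt hl)
  refine Set.Icc_subset_Icc (by positivity) ?_
  rw [← div_eq_mul_inv, div_le_one hn']
  exact_mod_cast hl

/-- A decoupling inequality for adapted measures at the dyadic scale `2^(-k) ∈ [1/(2n), 1/n]` gives
one on squares at scale `1/n`: dilating frequencies by `n / 2^k` moves the `n` caps of length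
`1/n` to the first `n` dyadic caps. -/
lemma isDecouplingBound_of_decouples {n k : ℕ} (hn : 0 < n) (hk : n ≤ 2 ^ k) (hk' : 2 ^ k ≤ 2 * n)
    {K : ℝ} (hK0 : 0 ≤ K) (hK : ∀ (μ : Measure Plane) [IsFiniteMeasure μ], Decouples μ k K) :
    IsDecouplingBound (n : ℝ)⁻¹ (2 ^ 200 * 2400 ^ 100 * ENNReal.ofReal (Real.sqrt K)) := by
  intro g hg c
  have hn' : (0 : ℝ) < n := by exact_mod_cast hn
  have hR : ((n : ℝ)⁻¹) ^ (-2 : ℤ) = (n : ℝ) ^ 2 := by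
    rw [inv_zpow, ← zpow_neg, neg_neg]; norm_cast
  have hfloor : ⌊((n : ℝ)⁻¹)⁻¹⌋₊ = n := by rw [inv_inv, Nat.floor_natCast]
  rw [squareSum, hR, hfloor]
  set R : ℝ := (n : ℝ) ^ 2 with hRdef
  have hR0 : 0 < R := by positivity
  have ha0 : 0 < 1 / (600 * R) := by positivity
  set μ := planeMeasure c (1 / (600 * R)) with hμ
  have hfin : IsFiniteMeasure μ := isFiniteMeasure_planeMeasure c ha0.ne'
  set lam : ℝ := 2 ^ k / n with hlam
  have hkR : (n : ℝ) ≤ 2 ^ k := by exact_mod_cast hk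
  have hkR' : (2 : ℝ) ^ k ≤ 2 * n := by exact_mod_cast hk'
  have hlam1 : 1 ≤ lam := by rw [hlam, one_le_div hn']; exact hkR
  have hlam0 : 0 < lam := by linarith
  have hadapt : Adapted μ (fun x => lam * x 0) (fun x => lam ^ 2 * x 1) (2 ^ k)⁻¹ := by
    refine adapted_planeMeasure c ha0 hlam1 ?_
    rw [inv_pow, hRdef, mul_one_div, div_le_iff₀ (by positivity), inv_mul_eq_div,
      le_div_iff₀ (by positivity)]
    have := pow_le_pow_left₀ (by positivity) hkR' 2
    nlinarith
  have happ : ∀ l : ℕ, ∃ A : ℕ → Plane → ℂ, l < n →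
      (∀ M, A M ∈ trig (fun x : Plane => x 0) (fun x => x 1)
        (arc (l * (n : ℝ)⁻¹) ((l + 1) * (n : ℝ)⁻¹))) ∧
      (∀ M x, ‖A M x‖ ≤ ∫ ξ in cap (n : ℝ)⁻¹ l, ‖g ξ‖) ∧
      ∀ x, Filter.Tendsto (fun M => A M x) Filter.atTop (nhds (extOp (cap (n : ℝ)⁻¹ l) g x)) := by
    intro l
    by_cases hl : l < n
    · obtain ⟨A, hA⟩ := exists_tendsto_extOp (a := l * (n : ℝ)⁻¹) (b := (l + 1) * (n : ℝ)⁻¹)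
        (by gcongr; linarith) (hg.mono_set (cap_subset hl))
      exact ⟨A, fun _ => hA⟩
    · exact ⟨0, fun h => absurd h hl⟩
  choose A hA using happ
  set f : ℕ → Plane → ℂ := fun l => if l < n then extOp (cap (n : ℝ)⁻¹ l) g else 0 with hf
  have hfl : ∀ l ∈ Finset.range n, f l = extOp (cap (n : ℝ)⁻¹ l) g := fun l hl => by
    rw [hf]; exact if_pos (Finset.mem_range.1 hl)
  have hf0 : ∀ l ∈ Finset.range (2 ^ k), l ∉ Finset.range n → f l = 0 := fun l _ hl => by
    rw [hf]; exact if_neg fun h => hl (Finset.mem_range.2 h)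
  have hsub : Finset.range n ⊆ Finset.range (2 ^ k) := Finset.range_subset_range.2 hk
  have hpsum : ∀ M, ParabolicSum μ (fun x => lam * x 0) (fun x => lam ^ 2 * x 1) k
      (fun l => if l < n then A l M else 0) := by
    intro M
    refine ⟨by fun_prop, by fun_prop, hadapt, fun l _ => ?_⟩
    by_cases hl : l < n
    · rw [if_pos hl]
      have h1 := (hA l hl).1 M
      have h2 := rescale_mem_trig (α := 0) (a := l / 2 ^ k) (b := (l + 1) / 2 ^ k) hlam0
        (f := A l M) (p := fun x : Plane => x 0) (q := fun x => x 1) (by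
          convert h1 using 3
          · rw [hlam]; field_simp; ring
          · rw [hlam]; field_simp; ring)
      convert h2 using 1
      · simp
      · ext x; simp [char, e_zero]
    · rw [if_neg hl]; exact Submodule.zero_mem _
  have key := (hK μ).of_tendsto (f := f) (C := fun l => ∫ ξ in cap (n : ℝ)⁻¹ l, ‖g ξ‖) hpsum (by
      intro M l _ x
      by_cases hl : l < n
      · simp only [if_pos hl]; exact (hA l hl).2.1 M x
      · simp only [if_neg hl, Pi.zero_apply, norm_zero]
        exact integral_nonneg fun _ => norm_nonneg _) (by
      intro l _ x
      by_cases hl : l < n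
      · simp only [hf, if_pos hl]; exact (hA l hl).2.2 x
      · simp only [hf, if_neg hl, Pi.zero_apply]; exact tendsto_const_nhds)
  have hbm : ∀ l ∈ Finset.range n, BddMeas (f l) := fun l hl => by
    have hl' := Finset.mem_range.1 hl
    rw [hfl l hl]
    exact (tendsto_lpNorm_six (μ := μ) (fun M => (bddMeas_of_mem_trig (by fun_prop) (by fun_prop)
      ((hA l hl').1 M)).meas) (hA l hl').2.1 (hA l hl').2.2).1
  rw [← Finset.sum_subset hsub hf0,
    ← Finset.sum_subset hsub fun l h1 h2 => by rw [hf0 l h1 h2]; simp] at key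
  have hsumf : extOp (Set.Icc 0 1) g = ∑ l ∈ Finset.range n, f l := by
    rw [extOp_eq_sum_cap hn hg]
    exact Finset.sum_congr rfl fun l hl => (hfl l hl).symm
  have hbsum : BddMeas (∑ l ∈ Finset.range n, f l) := by
    have := BddMeas.sum hbm
    convert this using 1
    ext x; simp
  have h200 : (1 : ENNReal) ≤ 2 ^ 200 := one_le_pow₀ (by norm_num)
  have h2400 : (1 : ENNReal) ≤ 2400 ^ 100 := one_le_pow₀ (by norm_num)
  have hT0 : 0 ≤ ∑ l ∈ Finset.range n, lpNorm (f l) 6 μ ^ 2 :=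
    Finset.sum_nonneg fun _ _ => sq_nonneg _
  have hright : ENNReal.ofReal (Real.sqrt (∑ l ∈ Finset.range n, lpNorm (f l) 6 μ ^ 2)) ≤
      2400 ^ 100 * (∑ l ∈ Finset.range n,
        normL6Weight c R (extOp (cap (n : ℝ)⁻¹ l) g) ^ 2) ^ (1 / 2 : ℝ) := by
    rw [Real.sqrt_eq_rpow, ← ENNReal.ofReal_rpow_of_nonneg hT0 (by norm_num),
      ENNReal.ofReal_sum_of_nonneg fun _ _ => sq_nonneg _]
    have hc2 : (2400 ^ 100 : ENNReal) = ((2400 ^ 100) ^ 2) ^ (1 / 2 : ℝ) := by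
      rw [← ENNReal.rpow_natCast (_ ^ 100) 2, ← ENNReal.rpow_mul]
      norm_num
    rw [hc2, ← ENNReal.mul_rpow_of_nonneg _ _ (by norm_num), Finset.mul_sum]
    refine ENNReal.rpow_le_rpow (Finset.sum_le_sum fun l hl => ?_) (by norm_num)
    rw [ENNReal.ofReal_pow lpNorm_nonneg, ofReal_lpNorm ((hbm l hl).memLp 6 μ), ← mul_pow,
      hfl l hl]
    gcongr
    exact eLpNorm_six_le_of_le_smul h2400 (planeMeasure_le c hR0) _
  calc normL6 c R (extOp (Set.Icc 0 1) g)
      ≤ 2 ^ 200 * eLpNorm (∑ l ∈ Finset.range n, f l) 6 μ := by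
        rw [hsumf]
        exact eLpNorm_six_le_of_le_smul h200 (restrict_square_le c hR0) _
    _ = 2 ^ 200 * ENNReal.ofReal (lpNorm (∑ l ∈ Finset.range n, f l) 6 μ) := by
        rw [ofReal_lpNorm (hbsum.memLp 6 μ)]
    _ ≤ 2 ^ 200 * ENNReal.ofReal
          (Real.sqrt K * Real.sqrt (∑ l ∈ Finset.range n, lpNorm (f l) 6 μ ^ 2)) := by
        gcongr
        rw [← Real.sqrt_mul hK0]
        exact Real.le_sqrt_of_sq_le key
    _ ≤ 2 ^ 200 * (ENNReal.ofReal (Real.sqrt K) * (2400 ^ 100 * (∑ l ∈ Finset.range n,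
        normL6Weight c R (extOp (cap (n : ℝ)⁻¹ l) g) ^ 2) ^ (1 / 2 : ℝ))) := by
        rw [ENNReal.ofReal_mul (Real.sqrt_nonneg _)]
        gcongr
    _ = _ := by ring

/-- The constants of the argument, `2^1400` from the transfer and `2^(N 2^N)`, `N = ⌈2/ε⌉`, from
the iteration, fit below `2^(200^(1/ε))`. -/
lemma exponent_le {ε : ℝ} (hε : 0 < ε) (hε' : ε < 1 / 100) :
    (1400 : ℝ) + ⌈2 / ε⌉₊ * 2 ^ ⌈2 / ε⌉₊ + 1 ≤ 200 ^ (1 / ε) := by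
  set u := 1 / ε with hu
  have hu100 : 100 ≤ u := by
    rw [hu, le_div_iff₀ hε]; linarith
  have h2u : 2 / ε = 2 * u := by rw [hu]; ring
  rw [h2u]
  have hN : (⌈2 * u⌉₊ : ℝ) ≤ 2 * u + 1 := (Nat.ceil_lt_add_one (by positivity)).le
  have hpow : (2 : ℝ) ^ ⌈2 * u⌉₊ ≤ 2 * 4 ^ u := by
    rw [← Real.rpow_natCast]
    calc (2 : ℝ) ^ (⌈2 * u⌉₊ : ℝ) ≤ 2 ^ (2 * u + 1) :=
          Real.rpow_le_rpow_of_exponent_le (by norm_num) hN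
      _ = 2 * 4 ^ u := by
          rw [Real.rpow_add (by norm_num), Real.rpow_mul (by norm_num), Real.rpow_one]
          norm_num [mul_comm]
  have h4 : (1 : ℝ) ≤ 4 ^ u := Real.one_le_rpow (by norm_num) (by linarith)
  have hbern : 1 + u * 49 ≤ (50 : ℝ) ^ u := by
    have := one_add_mul_self_le_rpow_one_add (s := 49) (by norm_num) (p := u) (by linarith)
    norm_num at this ⊢
    exact this
  have h200 : (200 : ℝ) ^ u = 50 ^ u * 4 ^ u := by
    rw [← Real.mul_rpow (by norm_num) (by norm_num)]; norm_num
  rw [h200]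
  calc (1400 : ℝ) + ⌈2 * u⌉₊ * 2 ^ ⌈2 * u⌉₊ + 1
      ≤ 1401 * 4 ^ u + (2 * u + 1) * (2 * 4 ^ u) := by
        have : (⌈2 * u⌉₊ : ℝ) * 2 ^ ⌈2 * u⌉₊ ≤ (2 * u + 1) * (2 * 4 ^ u) := by gcongr
        linarith
    _ = (1401 + (2 * u + 1) * 2) * 4 ^ u := by ring
    _ ≤ 50 ^ u * 4 ^ u := by
        gcongr
        linarith

end Transfer

end ParabolaDecoupling

end

theorem lemma2p10 (ε : ℝ) (hε : 0 < ε) (hε' : ε < 1 / 100)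
    (δ : ℝ) (hδ : δ ∈ ParabolaDecoupling.natInv) :
    ParabolaDecoupling.D δ ≤
      ENNReal.ofReal ((2 : ℝ) ^ ((200 : ℝ) ^ (1 / ε)) * δ ^ (-ε)) := by
  obtain ⟨n, hn, rfl⟩ := hδ
  have hn1 : (1 : ℝ) ≤ n := by exact_mod_cast hn
  set k := Nat.log 2 n + 1 with hk
  have hk1 : n ≤ 2 ^ k := (Nat.lt_pow_succ_log_self (by norm_num) n).le
  have hk2 : 2 ^ k ≤ 2 * n := by
    rw [hk, pow_succ, mul_comm]
    exact Nat.mul_le_mul_left 2 (Nat.pow_log_le_self 2 hn.ne')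
  refine (sInf_le (ParabolaDecoupling.isDecouplingBound_of_decouples hn hk1 hk2 (by positivity)
    fun μ _ => ParabolaDecoupling.decouples_of_pos hε hε' k)).trans ?_
  set P : ℕ := ⌈2 / ε⌉₊ * 2 ^ ⌈2 / ε⌉₊ with hP
  have hexp : (1400 : ℝ) + P + 1 ≤ 200 ^ (1 / ε) := by
    have := ParabolaDecoupling.exponent_le hε hε'
    rw [hP]; push_cast; exact this
  have hconst : (2 ^ 200 * 2400 ^ 100 : ENNReal) ≤ ENNReal.ofReal (2 ^ (1400 : ℝ)) := by
    have : (2 ^ 200 * 2400 ^ 100 : ENNReal) = ENNReal.ofReal (2 ^ 200 * 2400 ^ 100) := by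
      rw [ENNReal.ofReal_mul (by positivity), ENNReal.ofReal_pow (by norm_num),
        ENNReal.ofReal_pow (by norm_num), ENNReal.ofReal_ofNat, ENNReal.ofReal_ofNat]
    rw [this]
    refine ENNReal.ofReal_le_ofReal ?_
    rw [show (1400 : ℝ) = ((1400 : ℕ) : ℝ) by norm_num, Real.rpow_natCast]
    calc (2 : ℝ) ^ 200 * 2400 ^ 100 ≤ 2 ^ 200 * (2 ^ 12) ^ 100 := by gcongr; norm_num
      _ = 2 ^ 1400 := by rw [← pow_mul, ← pow_add]
  have hsqrt : Real.sqrt (2 ^ P * (2 : ℝ) ^ (2 * ε * k)) ≤ 2 ^ (P : ℝ) * (2 * (n : ℝ) ^ ε) := by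
    rw [Real.sqrt_mul (by positivity)]
    refine mul_le_mul ?_ ?_ (Real.sqrt_nonneg _) (by positivity)
    · rw [Real.rpow_natCast]
      refine Real.sqrt_le_iff.2 ⟨by positivity, ?_⟩
      have : (1 : ℝ) ≤ 2 ^ P := one_le_pow₀ (by norm_num)
      nlinarith
    · have h1 : (2 : ℝ) ^ (2 * ε * k) = ((2 ^ k : ℝ) ^ ε) ^ 2 := by
        rw [← Real.rpow_natCast 2 k, ← Real.rpow_mul (by norm_num), ← Real.rpow_natCast _ 2,
          ← Real.rpow_mul (by norm_num)]
        congr 1; push_cast; ring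
      rw [h1, Real.sqrt_sq (by positivity)]
      calc ((2 : ℝ) ^ k) ^ ε ≤ (2 * n) ^ ε :=
            Real.rpow_le_rpow (by positivity) (by exact_mod_cast hk2) hε.le
        _ = 2 ^ ε * (n : ℝ) ^ ε := Real.mul_rpow (by norm_num) (by positivity)
        _ ≤ 2 ^ (1 : ℝ) * (n : ℝ) ^ ε := by
            gcongr
            · norm_num
            · linarith
        _ = _ := by rw [Real.rpow_one]
  refine (mul_le_mul' hconst (ENNReal.ofReal_le_ofReal hsqrt)).trans ?_
  rw [← ENNReal.ofReal_mul (by positivity)]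
  refine ENNReal.ofReal_le_ofReal ?_
  have hδ : ((n : ℝ)⁻¹) ^ (-ε) = (n : ℝ) ^ ε := by
    rw [Real.rpow_neg (by positivity), Real.inv_rpow (by positivity), inv_inv]
  rw [hδ]
  calc (2 : ℝ) ^ (1400 : ℝ) * (2 ^ (P : ℝ) * (2 * (n : ℝ) ^ ε))
      = (2 : ℝ) ^ ((1400 : ℝ) + P + 1) * (n : ℝ) ^ ε := by
        rw [Real.rpow_add (by norm_num), Real.rpow_add (by norm_num), Real.rpow_one]; ring
    _ ≤ _ := by
        gcongr
        norm_num
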